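/- Let $\pi : (M,E) \to (\mathbb{R}^2,0)$ be a finite composition of point blowings-up of real analytic surfaces which starts with the blowing-up of the origin of $\mathbb{R}^2$ and in which each further center is a point of the exceptional divisor already created; $E = \pi^{-1}(0)$ is the exceptional divisor. A point $a \in E$ is a corner point if there are local analytic coordinates $(u,v)$ of $M$ centered at $a$ with $(E,a) = \{uv = 0\}$. In the ring $\mathcal{O}_{M,a}$ of real analytic function germs at $a$, let $I_{\pi,a}$ be the ideal generated by the germs $f\circ\pi$, where $f$ is an analytic function germ at the origin of $\mathbb{R}^2$ with $f(0)=0$, and let $J_{\pi,a}$ be the ideal generated by the determinant of $d\pi$, computed in local analytic coordinates of $M$ at $a$. (i) For any non-corner point $a$ of $E$ there exist local analytic coordinates $(u,v)$ centered at $a$ such that $(E,a) = \{u = 0\}$, $I_{\pi,a} = (u^{l})$ and $J_{\pi,a} = (u^{\bar l})$ with $\bar l \ge 2l-1$. Moreover, up to a rotation in the target $(\mathbb{R}^2,0)$, the mapping $\pi$ is written in these coordinates near $a$ as $$(u,v) \mapsto \bigl(\alpha u^{l},\; u^{l}\varphi(u) + \beta u^{m} v\bigr),$$ where $l \le m$ are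 positive integers, $\varphi$ is a real analytic function near $0 \in \mathbb{R}$ and $\alpha,\beta \in \{-1,+1\}$. Moreover $\bar l = l + m - 1$. (ii) For any corner point $a$ of $E$ there exist local analytic coordinates $(u,v)$ centered at $a$ such that $(E,a) = \{uv = 0\}$, $I_{\pi,a} = (u^{l} v^{m})$ and $J_{\pi,a} = (u^{\bar l} v^{\bar m})$ with $\bar l \ge 2l-1$ and $\bar m \ge 2m-1$. Moreover, up to a rotation in the target $(\mathbb{R}^2,0)$, the mapping $\pi$ is written in these coordinates near $a$ as $$(u,v) \mapsto \bigl(\alpha u^{l} v^{m},\; \varphi(u^{l} v^{m}) + \beta u^{n} v^{p}\bigr),$$ where $l \le n$ and $m \le p$ are positive integers such that the plane vectors $(l,m)$ and $(n,p)$ are not collinear, $\alpha,\beta \in \{-1,+1\}$, and $\varphi(t) = t\, h(t^{1/e})$ for a function $h$ real analytic near $0 \in \mathbb{R}$ and a positive common divisor $e$ of $l$ and $m$, the $e$-th root of $t = u^{l} v^{m}$ being the monomial $u^{l/e} v^{m/e}$; that is, $\varphi(u^{l} v^{m})$ stands for $u^{l} v^{m}\, h(u^{l/e} v^{m/e})$.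 Moreover $\bar l = l + n - 1$ and $\bar m = m + p - 1$. -/

import Mathlib

universe u

open Filter Topology
open scoped Manifold ContDiff

/-! Real analytic surfaces are manifolds `M` modelled on `ℝ × ℝ` with
`IsManifold 𝓘(ℝ, ℝ × ℝ) ω M`. -/

section Coordinates

variable {M : Type*} [TopologicalSpace M] [ChartedSpace (ℝ × ℝ) M]

/-- `ψ = (u, v)` is a system of local analytic coordinates of the surface `M` centered at `a`. -/
structure IsAnalyticCoord (ψ : OpenPartialHomeomorph M (ℝ × ℝ)) (a : M) : Prop where
  mem_maximalAtlas : ψ ∈ IsManifold.maximalAtlas 𝓘(ℝ, ℝ × ℝ) ω M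
  mem_source : a ∈ ψ.source
  map_center : ψ a = 0

/-- The germ equality `(E, a) = {u = 0}`. -/
def GermEqAxis (E : Set M) (ψ : OpenPartialHomeomorph M (ℝ × ℝ)) (a : M) : Prop :=
  ∀ᶠ q in 𝓝 a, q ∈ E ↔ (ψ q).1 = 0

/-- The germ equality `(E, a) = {u * v = 0}`. -/
def GermEqCross (E : Set M) (ψ : OpenPartialHomeomorph M (ℝ × ℝ)) (a : M) : Prop :=
  ∀ᶠ q in 𝓝 a, q ∈ E ↔ (ψ q).1 * (ψ q).2 = 0

/-- `a` is a corner point of `E`: in suitable local analytic coordinates `(u, v)` centered at `a`,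
`(E, a) = {u * v = 0}`. -/
def IsCornerPoint (E : Set M) (a : M) : Prop :=
  ∃ ψ : OpenPartialHomeomorph M (ℝ × ℝ), IsAnalyticCoord ψ a ∧ GermEqCross E ψ a

end Coordinates

section Blowup

/-- `γ : M₁ → M` is the blowing-up of the point `p` of the analytic surface `M`: it is an analytic
isomorphism from `M₁ \ γ⁻¹(p)` onto `M \ {p}`, and for some analytic coordinates `c` of `M` centered
at `p`, with domain `U`, the preimage `γ⁻¹(U)` is covered by two analytic charts `c₁`, `c₂`, in which
`γ` reads `(x, y) ↦ (x, x y)` and `(x, y) ↦ (x y, y)`, whose images are the full preimages of `c(U)`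
under these two maps, and which are glued by `(x, y) ↦ (1 / y, x y)`, `y ≠ 0`. -/
structure IsPointBlowup {M₁ M : Type*} [TopologicalSpace M₁] [ChartedSpace (ℝ × ℝ) M₁]
    [TopologicalSpace M] [ChartedSpace (ℝ × ℝ) M] (γ : M₁ → M) (p : M) : Prop where
  analytic : ContMDiff 𝓘(ℝ, ℝ × ℝ) 𝓘(ℝ, ℝ × ℝ) ω γ
  bijOn : Set.BijOn γ (γ ⁻¹' {p})ᶜ {p}ᶜ
  localIso : ∀ q : M₁, γ q ≠ p → IsLocalDiffeomorphAt 𝓘(ℝ, ℝ × ℝ) 𝓘(ℝ, ℝ × ℝ) ω γ q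
  charts : ∃ (c : OpenPartialHomeomorph M (ℝ × ℝ)) (c₁ c₂ : OpenPartialHomeomorph M₁ (ℝ × ℝ)),
    IsAnalyticCoord c p ∧
    c₁ ∈ IsManifold.maximalAtlas 𝓘(ℝ, ℝ × ℝ) ω M₁ ∧
    c₂ ∈ IsManifold.maximalAtlas 𝓘(ℝ, ℝ × ℝ) ω M₁ ∧
    γ ⁻¹' c.source = c₁.source ∪ c₂.source ∧
    c₁.target = {z : ℝ × ℝ | (z.1, z.1 * z.2) ∈ c.target} ∧
    c₂.target = {z : ℝ × ℝ | (z.1 * z.2, z.2) ∈ c.target} ∧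
    (∀ q ∈ c₁.source, c (γ q) = ((c₁ q).1, (c₁ q).1 * (c₁ q).2)) ∧
    (∀ q ∈ c₂.source, c (γ q) = ((c₂ q).1 * (c₂ q).2, (c₂ q).2)) ∧
    (∀ q ∈ c₁.source, q ∈ c₂.source ↔ (c₁ q).2 ≠ 0) ∧
    (∀ q ∈ c₁.source ∩ c₂.source, c₂ q = ((c₁ q).2⁻¹, (c₁ q).1 * (c₁ q).2))

/-- The exceptional divisor `E = π⁻¹(0)` of a composition of point blowings-up over the origin: the
inverse image of the origin under the first blowing-up, and then, each time a point of `E` is blown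
up, the inverse image of `E`, that is the new component together with the strict transform of `E`. -/
def exceptionalDivisor {M : Type*} (π : M → ℝ × ℝ) : Set M := π ⁻¹' {0}

/-- `π : (M, E) → (ℝ², 0)` is a finite composition of point blowings-up, starting with the
blowing-up of the origin, each further center being a point of the exceptional divisor. -/
inductive IsBlowupComposition : ∀ {M : Type u} [TopologicalSpace M] [ChartedSpace (ℝ × ℝ) M]
    (_ : M → ℝ × ℝ), Prop
  | origin {M : Type u} [TopologicalSpace M] [ChartedSpace (ℝ × ℝ) M]
      [IsManifold 𝓘(ℝ, ℝ × ℝ) ω M] (γ : M → ℝ × ℝ) (hγ : IsPointBlowup γ (0 : ℝ × ℝ)) :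
      IsBlowupComposition γ
  | step {M M₁ : Type u} [TopologicalSpace M] [ChartedSpace (ℝ × ℝ) M]
      [IsManifold 𝓘(ℝ, ℝ × ℝ) ω M] [TopologicalSpace M₁] [ChartedSpace (ℝ × ℝ) M₁]
      [IsManifold 𝓘(ℝ, ℝ × ℝ) ω M₁] (π : M → ℝ × ℝ) (hπ : IsBlowupComposition π)
      (p : M) (hp : p ∈ exceptionalDivisor π) (γ : M₁ → M) (hγ : IsPointBlowup γ p) :
      IsBlowupComposition (π ∘ γ)

end Blowup

section Ideals

variable {M : Type*} [TopologicalSpace M] [ChartedSpace (ℝ × ℝ) M]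

/-- The ring of germs at `a` of real analytic functions on `M`. -/
def analyticGerms (a : M) : Subring (Germ (𝓝 a) ℝ) where
  carrier := {g | ∃ f : M → ℝ, ContMDiffAt 𝓘(ℝ, ℝ × ℝ) 𝓘(ℝ, ℝ) ω f a ∧ g = (f : Germ (𝓝 a) ℝ)}
  mul_mem' := by
    rintro _ _ ⟨f, hf, rfl⟩ ⟨g, hg, rfl⟩
    exact ⟨f * g, hf.mul hg, rfl⟩
  one_mem' := ⟨fun _ => 1, contMDiffAt_const, rfl⟩
  add_mem' := by
    rintro _ _ ⟨f, hf, rfl⟩ ⟨g, hg, rfl⟩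
    exact ⟨f + g, hf.add hg, rfl⟩
  zero_mem' := ⟨fun _ => 0, contMDiffAt_const, rfl⟩
  neg_mem' := by
    rintro _ ⟨f, hf, rfl⟩
    exact ⟨-f, hf.neg, rfl⟩

/-- The ideal of the ring of analytic germs at `a` generated by the (analytic) germs at `a` of the
functions in `S`. -/
def germIdeal (a : M) (S : Set (M → ℝ)) : Ideal (analyticGerms a) :=
  Ideal.span {x | ∃ f ∈ S, (x : Germ (𝓝 a) ℝ) = (f : Germ (𝓝 a) ℝ)}

/-- The stalk at `a` of the pull-back by `π` of the maximal ideal of the ring of analytic germs at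
the origin of `ℝ²`. -/
def pullbackIdeal (π : M → ℝ × ℝ) (a : M) : Ideal (analyticGerms a) :=
  germIdeal a {F | ∃ f : ℝ × ℝ → ℝ, AnalyticAt ℝ f 0 ∧ f 0 = 0 ∧ F = f ∘ π}

/-- The stalk at `a` of the ideal generated by the determinant of `dπ`, computed in local analytic
coordinates `ψ` at `a` (two choices of `ψ` give determinants that differ by a unit). -/
def jacobianIdeal (π : M → ℝ × ℝ) (a : M) : Ideal (analyticGerms a) :=
  germIdeal a {F | ∃ ψ : OpenPartialHomeomorph M (ℝ × ℝ), IsAnalyticCoord ψ a ∧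
    F = fun q => (fderiv ℝ (π ∘ ψ.symm) (ψ q)).det}

end Ideals

/-- The rotation of `ℝ²` of angle `θ` around the origin. -/
noncomputable def planeRotation (θ : ℝ) (z : ℝ × ℝ) : ℝ × ℝ :=
  (Real.cos θ * z.1 - Real.sin θ * z.2, Real.sin θ * z.1 + Real.cos θ * z.2)

/-! ### Germs of coordinate systems and changes of coordinates -/

section CoordinateGerms

variable {M : Type*} [TopologicalSpace M] [ChartedSpace (ℝ × ℝ) M]

/-! The two normal forms are stable under blowing up, so induction on the number of blowings-up
gives one of them at every point of the divisor (`IsBlowupComposition.hasForm`). The rotation is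
fixed by the first blowing-up and never changes. Away from the center nothing happens. Over the
center, in coordinates prescribed there, the blowing-up reads `(x, x * (y + y₁))` or `(x * y, y)`
(`IsPointBlowup.exists_form`).

From an axis form, the first substitution adds a pure power of `x`, which `φ` absorbs. The second
creates a corner, where `φ` is evaluated at `x * y` while the first component is `± (x * y) ^ l`:
this is the origin of the root `t ^ (1 / e)`, with `e = l`. Write the exponents `l, m` of a cross
form as `k * e, j * e` and put `s = u ^ k * v ^ j`. At the two corners over the center, `(k, j)` and
`(n, p)` undergo the same elementary transformation, so `e` and `k * p - j * n` are preserved. At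
any other point over the center, `y₁ ≠ 0`, and `x * |y + y₁| ^ κ` serves as the first coordinate,
with `κ` chosen so that `s` becomes `±` a power of it. Then `u ^ n * v ^ p` becomes `±` a power of
the same coordinate times `|y + y₁| ^ δ`, with `δ ≠ 0` by non-collinearity, so that `|y + y₁| ^ δ`
minus its value at the point is a second coordinate.

The ideals and the divisor are read off the forms. The second component is a multiple of the first,
and the Jacobian determinant is a nonzero constant times a monomial. Finally, cross forms occur
exactly at corner points, by definition in one direction and by `not_isCornerPoint_of_axis` in the
other. -/

/-- `X` has the germ at `a` of a system of local analytic coordinates centered at `a`. -/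
def IsCoordGerm (X : M → ℝ × ℝ) (a : M) : Prop :=
  ∃ ψ : OpenPartialHomeomorph M (ℝ × ℝ), IsAnalyticCoord ψ a ∧ X =ᶠ[𝓝 a] ψ

theorem IsAnalyticCoord.isCoordGerm {ψ : OpenPartialHomeomorph M (ℝ × ℝ)} {a : M}
    (h : IsAnalyticCoord ψ a) : IsCoordGerm ψ a := ⟨ψ, h, EventuallyEq.rfl⟩

theorem IsAnalyticCoord.contMDiffAt [IsManifold 𝓘(ℝ, ℝ × ℝ) ω M]
    {ψ : OpenPartialHomeomorph M (ℝ × ℝ)} {a : M}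
    (h : IsAnalyticCoord ψ a) : ContMDiffAt 𝓘(ℝ, ℝ × ℝ) 𝓘(ℝ, ℝ × ℝ) ω ψ a :=
  contMDiffAt_of_mem_maximalAtlas h.mem_maximalAtlas h.mem_source

theorem IsCoordGerm.apply_eq {X : M → ℝ × ℝ} {a : M} (h : IsCoordGerm X a) : X a = 0 := by
  obtain ⟨ψ, hψ, e⟩ := h
  rw [e.self_of_nhds, hψ.map_center]

theorem IsCoordGerm.continuousAt {X : M → ℝ × ℝ} {a : M} (h : IsCoordGerm X a) :
    ContinuousAt X a := by
  obtain ⟨ψ, hψ, e⟩ := h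
  exact (ψ.continuousAt hψ.mem_source).congr e.symm

theorem IsCoordGerm.tendsto {X : M → ℝ × ℝ} {a : M} (h : IsCoordGerm X a) :
    Tendsto X (𝓝 a) (𝓝 0) := by
  simpa [h.apply_eq] using h.continuousAt.tendsto

theorem OpenPartialHomeomorph.trans_mem_maximalAtlas [IsManifold 𝓘(ℝ, ℝ × ℝ) ω M]
    {ψ : OpenPartialHomeomorph M (ℝ × ℝ)} (hψ : ψ ∈ IsManifold.maximalAtlas 𝓘(ℝ, ℝ × ℝ) ω M)
    {e : OpenPartialHomeomorph (ℝ × ℝ) (ℝ × ℝ)} (he : ∀ z ∈ e.source, AnalyticAt ℝ e z)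
    (he' : ∀ z ∈ e.target, AnalyticAt ℝ e.symm z) :
    ψ.trans e ∈ IsManifold.maximalAtlas 𝓘(ℝ, ℝ × ℝ) ω M := by
  have h1 : ContMDiffOn 𝓘(ℝ, ℝ × ℝ) 𝓘(ℝ, ℝ × ℝ) ω e e.source := fun z hz =>
    ((he z hz).contDiffAt.contMDiffAt).contMDiffWithinAt
  have h2 : ContMDiffOn 𝓘(ℝ, ℝ × ℝ) 𝓘(ℝ, ℝ × ℝ) ω e.symm e.target := fun z hz =>
    ((he' z hz).contDiffAt.contMDiffAt).contMDiffWithinAt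
  refine OpenPartialHomeomorph.mem_maximalAtlas_of_contMDiffOn _ ?_ ?_
  · exact h1.comp ((contMDiffOn_of_mem_maximalAtlas hψ).mono (by intro x hx; simp at hx; exact hx.1))
      (by intro x hx; simp at hx; exact hx.2)
  · exact (contMDiffOn_symm_of_mem_maximalAtlas hψ).comp
      (h2.mono (by intro x hx; simp at hx; exact hx.1)) (by intro x hx; simp at hx; exact hx.2)

/-- Inverse function theorem, followed by shrinking the source and then the target to the open sets
where the map and its inverse are analytic. -/
theorem exists_openPartialHomeomorph_of_analyticAt {g : ℝ × ℝ → ℝ × ℝ} {z : ℝ × ℝ}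
    (hg : AnalyticAt ℝ g z) {L : (ℝ × ℝ) ≃L[ℝ] ℝ × ℝ}
    (hL : HasFDerivAt g (L : ℝ × ℝ →L[ℝ] ℝ × ℝ) z) :
    ∃ e : OpenPartialHomeomorph (ℝ × ℝ) (ℝ × ℝ), z ∈ e.source ∧ (∀ x, e x = g x) ∧
      (∀ x ∈ e.source, AnalyticAt ℝ e x) ∧ ∀ y ∈ e.target, AnalyticAt ℝ e.symm y := by
  have hc : ContDiffAt ℝ ω g z := hg.contDiffAt
  set e := hc.toOpenPartialHomeomorph g hL (by simp) with he
  have hez : z ∈ e.source := hc.mem_toOpenPartialHomeomorph_source hL (by simp)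
  have hs : AnalyticAt ℝ e.symm (e z) := by
    refine (e.contDiffAt_symm (n := ω) (f₀' := L) (e.map_source hez) ?_ ?_).analyticAt
    · rw [e.left_inv hez]; exact hL
    · rw [e.left_inv hez]; exact hc
  refine ⟨((e.restrOpen _ (isOpen_analyticAt ℝ g)).symm.restrOpen _
    (isOpen_analyticAt ℝ e.symm)).symm, ?_, fun _ => rfl, ?_, ?_⟩
  · simp [hez, hg]
    exact hs
  · intro x hx
    simp at hx
    exact hx.1.2
  · intro y hy
    simp at hy
    exact hy.2

theorem IsCoordGerm.comp_analytic [IsManifold 𝓘(ℝ, ℝ × ℝ) ω M] {X : M → ℝ × ℝ} {a : M}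
    (h : IsCoordGerm X a) {g : ℝ × ℝ → ℝ × ℝ} (hg : AnalyticAt ℝ g 0) (hg0 : g 0 = 0)
    {L : (ℝ × ℝ) ≃L[ℝ] ℝ × ℝ} (hL : HasFDerivAt g (L : ℝ × ℝ →L[ℝ] ℝ × ℝ) 0) :
    IsCoordGerm (g ∘ X) a := by
  obtain ⟨ψ, hψ, e⟩ := h
  obtain ⟨f, hf0, hf, hf1, hf2⟩ := exists_openPartialHomeomorph_of_analyticAt hg hL
  refine ⟨ψ.trans f, ⟨OpenPartialHomeomorph.trans_mem_maximalAtlas hψ.mem_maximalAtlas hf1 hf2,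
    ?_, ?_⟩, ?_⟩
  · simp [hψ.mem_source, hψ.map_center, hf0]
  · simp [hψ.map_center, hf, hg0]
  · filter_upwards [e] with q hq
    simp [hq, hf]

theorem IsCoordGerm.comp_localDiffeo {N : Type*} [TopologicalSpace N] [ChartedSpace (ℝ × ℝ) N]
    [IsManifold 𝓘(ℝ, ℝ × ℝ) ω M] [IsManifold 𝓘(ℝ, ℝ × ℝ) ω N] {X : M → ℝ × ℝ} {γ : N → M} {q : N}
    (h : IsCoordGerm X (γ q)) (hγ : IsLocalDiffeomorphAt 𝓘(ℝ, ℝ × ℝ) 𝓘(ℝ, ℝ × ℝ) ω γ q) :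
    IsCoordGerm (X ∘ γ) q := by
  have hcont := hγ.contMDiffAt.continuousAt
  obtain ⟨ψ, hψ, e⟩ := h
  obtain ⟨Φ, hq, hΦ⟩ := hγ
  refine ⟨Φ.toOpenPartialHomeomorph.trans ψ, ⟨?_, ?_, ?_⟩, ?_⟩
  · refine OpenPartialHomeomorph.mem_maximalAtlas_of_contMDiffOn _ ?_ ?_
    · exact (contMDiffOn_of_mem_maximalAtlas hψ.mem_maximalAtlas).comp
        (Φ.contMDiffOn_toFun.mono (by intro x hx; exact hx.1)) (by intro x hx; exact hx.2)
    · exact Φ.contMDiffOn_invFun.comp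
        ((contMDiffOn_symm_of_mem_maximalAtlas hψ.mem_maximalAtlas).mono
          (by intro x hx; exact hx.1)) (by intro x hx; exact hx.2)
  · refine ⟨hq, ?_⟩
    change Φ q ∈ ψ.source
    rw [← hΦ hq]; exact hψ.mem_source
  · change ψ (Φ q) = 0
    rw [← hΦ hq]; exact hψ.map_center
  · filter_upwards [Φ.open_source.mem_nhds hq, hcont.eventually e] with x hx hx'
    change X (γ x) = ψ (Φ x)
    rw [hx', hΦ hx]

theorem isCoordGerm_sub_of_mem_maximalAtlas [IsManifold 𝓘(ℝ, ℝ × ℝ) ω M]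
    {c : OpenPartialHomeomorph M (ℝ × ℝ)} (hc : c ∈ IsManifold.maximalAtlas 𝓘(ℝ, ℝ × ℝ) ω M)
    {a : M} (ha : a ∈ c.source) : IsCoordGerm (fun q => c q - c a) a := by
  refine ⟨c.trans (Homeomorph.subRight (c a)).toOpenPartialHomeomorph, ⟨?_, ?_, ?_⟩, ?_⟩
  · refine OpenPartialHomeomorph.trans_mem_maximalAtlas hc ?_ ?_
    · intro z _
      exact analyticAt_id.sub analyticAt_const
    · intro z _
      change AnalyticAt ℝ (Homeomorph.subRight (c a)).symm z
      have : ((Homeomorph.subRight (c a)).symm : ℝ × ℝ → ℝ × ℝ) = fun x => x + c a := by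
        ext x <;> simp
      rw [this]
      exact analyticAt_id.add analyticAt_const
  · simp [ha]
  · simp
  · exact Eventually.of_forall fun q => by simp

/-- Two systems of coordinates centered at the same point differ by an analytic isomorphism. -/
theorem IsCoordGerm.exists_transition [IsManifold 𝓘(ℝ, ℝ × ℝ) ω M] {X : M → ℝ × ℝ} {a : M}
    (h : IsCoordGerm X a) {c : OpenPartialHomeomorph M (ℝ × ℝ)} (hc : IsAnalyticCoord c a) :
    ∃ (g : ℝ × ℝ → ℝ × ℝ) (L : (ℝ × ℝ) ≃L[ℝ] ℝ × ℝ), AnalyticAt ℝ g 0 ∧ g 0 = 0 ∧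
      HasFDerivAt g (L : ℝ × ℝ →L[ℝ] ℝ × ℝ) 0 ∧ X =ᶠ[𝓝 a] g ∘ c := by
  obtain ⟨ψ, hψ, e⟩ := h
  have key : ∀ {c d : OpenPartialHomeomorph M (ℝ × ℝ)}, IsAnalyticCoord c a →
      IsAnalyticCoord d a → AnalyticAt ℝ (d ∘ c.symm) 0 := by
    intro c d hc hd
    have hs : c.symm 0 = a := by rw [← hc.map_center, c.left_inv hc.mem_source]
    have h1 : ContMDiffAt 𝓘(ℝ, ℝ × ℝ) 𝓘(ℝ, ℝ × ℝ) ω c.symm 0 :=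
      contMDiffAt_symm_of_mem_maximalAtlas hc.mem_maximalAtlas
        (by rw [← hc.map_center]; exact c.map_source hc.mem_source)
    have h2 : ContMDiffAt 𝓘(ℝ, ℝ × ℝ) 𝓘(ℝ, ℝ × ℝ) ω d (c.symm 0) := by
      rw [hs]; exact hd.contMDiffAt
    exact (h2.comp 0 h1).contDiffAt.analyticAt
  have inv : ∀ {c d : OpenPartialHomeomorph M (ℝ × ℝ)}, IsAnalyticCoord c a →
      IsAnalyticCoord d a → ∀ᶠ z in 𝓝 (0 : ℝ × ℝ), (c ∘ d.symm) ((d ∘ c.symm) z) = z := by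
    intro c d hc hd
    have hs : c.symm 0 = a := by rw [← hc.map_center, c.left_inv hc.mem_source]
    have h0 : (0 : ℝ × ℝ) ∈ c.target := by
      rw [← hc.map_center]; exact c.map_source hc.mem_source
    have hct : ContinuousAt c.symm 0 := c.symm.continuousAt h0
    filter_upwards [c.open_target.mem_nhds h0, hct.preimage_mem_nhds
      (d.open_source.mem_nhds (by rw [hs]; exact hd.mem_source))] with z hz hz'
    have : d.symm (d (c.symm z)) = c.symm z := d.left_inv hz'
    simp [this, c.right_inv hz]
  have z0 : ∀ {c d : OpenPartialHomeomorph M (ℝ × ℝ)}, IsAnalyticCoord c a →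
      IsAnalyticCoord d a → (d ∘ c.symm) 0 = 0 := by
    intro c d hc hd
    have hs : c.symm 0 = a := by rw [← hc.map_center, c.left_inv hc.mem_source]
    simp [hs, hd.map_center]
  -- Stated for an arbitrary ordered pair of charts: used both ways, it makes the differential of
  -- the transition invertible.
  have comp : ∀ {c d : OpenPartialHomeomorph M (ℝ × ℝ)}, IsAnalyticCoord c a →
      IsAnalyticCoord d a → (fderiv ℝ (c ∘ d.symm) 0).comp (fderiv ℝ (d ∘ c.symm) 0) =
        ContinuousLinearMap.id ℝ (ℝ × ℝ) := by
    intro c d hc hd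
    have h1 := (key hc hd).differentiableAt.hasFDerivAt
    have h2 : HasFDerivAt (c ∘ d.symm) (fderiv ℝ (c ∘ d.symm) 0) ((d ∘ c.symm) 0) := by
      rw [z0 hc hd]; exact (key hd hc).differentiableAt.hasFDerivAt
    have h3 := h2.comp 0 h1
    have h4 : HasFDerivAt ((c ∘ d.symm) ∘ (d ∘ c.symm)) (ContinuousLinearMap.id ℝ (ℝ × ℝ)) 0 :=
      (hasFDerivAt_id _).congr_of_eventuallyEq (inv hc hd)
    exact h3.unique h4
  refine ⟨ψ ∘ c.symm, ContinuousLinearEquiv.equivOfInverse (fderiv ℝ (ψ ∘ c.symm) 0)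
    (fderiv ℝ (c ∘ ψ.symm) 0) (fun x => ?_) (fun x => ?_), key hc hψ, z0 hc hψ, ?_, ?_⟩
  · exact DFunLike.congr_fun (comp hc hψ) x
  · exact DFunLike.congr_fun (comp hψ hc) x
  · exact (key hc hψ).differentiableAt.hasFDerivAt
  · filter_upwards [e, c.open_source.mem_nhds hc.mem_source] with q hq hq'
    simp [hq, c.left_inv hq']

end CoordinateGerms

/-! ### Plane linear maps and Hadamard's lemma -/

section Analytic

theorem continuousLinearMap_prod_ext {F : Type*} [NormedAddCommGroup F] [NormedSpace ℝ F]
    {A B : ℝ × ℝ →L[ℝ] F} (h1 : A (1, 0) = B (1, 0)) (h2 : A (0, 1) = B (0, 1)) : A = B := by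
  ext <;> simpa

/-- The endomorphism of `ℝ²` with matrix `!![a, b; c, d]`. -/
noncomputable def planeMap (a b c d : ℝ) : ℝ × ℝ →L[ℝ] ℝ × ℝ :=
  (a • ContinuousLinearMap.fst ℝ ℝ ℝ + b • ContinuousLinearMap.snd ℝ ℝ ℝ).prod
    (c • ContinuousLinearMap.fst ℝ ℝ ℝ + d • ContinuousLinearMap.snd ℝ ℝ ℝ)

@[simp] theorem planeMap_apply (a b c d : ℝ) (z : ℝ × ℝ) :
    planeMap a b c d z = (a * z.1 + b * z.2, c * z.1 + d * z.2) := by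
  simp [planeMap]

theorem eq_planeMap (L : ℝ × ℝ →L[ℝ] ℝ × ℝ) :
    L = planeMap (L (1, 0)).1 (L (0, 1)).1 (L (1, 0)).2 (L (0, 1)).2 :=
  continuousLinearMap_prod_ext (by simp) (by simp)

theorem planeMap_det (a b c d : ℝ) : (planeMap a b c d).det = a * d - b * c := by
  rw [ContinuousLinearMap.det, ← LinearMap.det_toMatrix (Module.Basis.finTwoProd ℝ),
    Matrix.det_fin_two]
  simp [LinearMap.toMatrix_apply, planeMap]

/-- A map with an invertible matrix is a continuous linear equivalence. -/
noncomputable def planeEquiv (a b c d : ℝ) (h : a * d - b * c ≠ 0) : (ℝ × ℝ) ≃L[ℝ] ℝ × ℝ :=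
  ContinuousLinearEquiv.equivOfInverse (planeMap a b c d)
    (planeMap (d / (a * d - b * c)) (-b / (a * d - b * c)) (-c / (a * d - b * c))
      (a / (a * d - b * c)))
    (fun z => by
      generalize hδ : a * d - b * c = δ at h
      ext <;> simp <;> field_simp
      exacts [by linear_combination z.1 * hδ, by linear_combination z.2 * hδ])
    (fun z => by
      generalize hδ : a * d - b * c = δ at h
      ext <;> simp <;> field_simp
      exacts [by linear_combination z.1 * hδ, by linear_combination z.2 * hδ])

/-- The differential at the origin of an analytic map, from its restrictions to the axes. -/
theorem AnalyticAt.hasFDerivAt_planeMap {F : ℝ × ℝ → ℝ × ℝ} (hF : AnalyticAt ℝ F 0) {a b c d : ℝ}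
    (ha : HasDerivAt (fun x => (F (x, 0)).1) a 0) (hb : HasDerivAt (fun y => (F (0, y)).1) b 0)
    (hc : HasDerivAt (fun x => (F (x, 0)).2) c 0) (hd : HasDerivAt (fun y => (F (0, y)).2) d 0) :
    HasFDerivAt F (planeMap a b c d) 0 := by
  have hD := hF.differentiableAt.hasFDerivAt
  have hx : HasDerivAt (fun x : ℝ => ((x, 0) : ℝ × ℝ)) (1, 0) 0 :=
    (hasDerivAt_id (0 : ℝ)).prodMk (hasDerivAt_const _ _)
  have hy : HasDerivAt (fun y : ℝ => ((0, y) : ℝ × ℝ)) (0, 1) 0 :=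
    (hasDerivAt_const _ _).prodMk (hasDerivAt_id (0 : ℝ))
  have h1 : HasDerivAt (fun x => F (x, 0)) (fderiv ℝ F 0 (1, 0)) 0 :=
    HasFDerivAt.comp_hasDerivAt (f := fun x : ℝ => ((x, 0) : ℝ × ℝ)) 0 hD hx
  have h2 : HasDerivAt (fun x => F (0, x)) (fderiv ℝ F 0 (0, 1)) 0 :=
    HasFDerivAt.comp_hasDerivAt (f := fun x : ℝ => ((0, x) : ℝ × ℝ)) 0 hD hy
  have e1 := h1.unique (ha.prodMk hc)
  have e2 := h2.unique (hb.prodMk hd)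
  rw [eq_planeMap (fderiv ℝ F 0), e1, e2] at hD
  exact hD

/-- Working test for new coordinates: only four one-variable derivatives along the axes have to be
computed. -/
theorem IsCoordGerm.comp_of_partials {M : Type*} [TopologicalSpace M] [ChartedSpace (ℝ × ℝ) M]
    [IsManifold 𝓘(ℝ, ℝ × ℝ) ω M] {X : M → ℝ × ℝ} {q : M} (h : IsCoordGerm X q)
    {F : ℝ × ℝ → ℝ × ℝ} (hF : AnalyticAt ℝ F 0) (hF0 : F 0 = 0) {a b c d : ℝ}
    (ha : HasDerivAt (fun x => (F (x, 0)).1) a 0) (hb : HasDerivAt (fun y => (F (0, y)).1) b 0)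
    (hc : HasDerivAt (fun x => (F (x, 0)).2) c 0) (hd : HasDerivAt (fun y => (F (0, y)).2) d 0)
    (hdet : a * d - b * c ≠ 0) : IsCoordGerm (F ∘ X) q :=
  h.comp_analytic (L := planeEquiv a b c d hdet) hF hF0 (hF.hasFDerivAt_planeMap ha hb hc hd)

/-- Hadamard's lemma for analytic functions. -/
theorem AnalyticAt.exists_eq_add_apply {E F : Type*} [NormedAddCommGroup E] [NormedSpace ℝ E]
    [NormedAddCommGroup F] [NormedSpace ℝ F] [CompleteSpace F] {f : E → F}
    (hf : AnalyticAt ℝ f 0) :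
    ∃ A : E → (E →L[ℝ] F), AnalyticAt ℝ A 0 ∧ ∀ᶠ z in 𝓝 0, f z = f 0 + A z z := by
  obtain ⟨p, r, hp⟩ := hf
  have hr : 0 < p.shift.radius := by
    rw [FormalMultilinearSeries.radius_shift]; exact hp.r_pos.trans_le hp.r_le
  -- `A` is the sum of the series with one argument of each term left free; reinserting that
  -- argument restores the original series.
  have hA := p.shift.hasFPowerSeriesOnBall hr
  refine ⟨p.shift.sum, ⟨_, _, hA⟩, ?_⟩
  have hU := hA.unshift (z := f 0)
  have e : p.shift.unshift (f 0) = p := by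
    ext n v
    cases n with
    | zero => simp [FormalMultilinearSeries.unshift, ← hp.coeff_zero v]
    | succ n =>
      simp [FormalMultilinearSeries.unshift, FormalMultilinearSeries.shift]
  rw [e] at hU
  filter_upwards [hp.hasFPowerSeriesAt.eventually_hasSum,
    hU.hasFPowerSeriesAt.eventually_hasSum] with z h1 h2
  simpa using h1.unique h2

end Analytic

/-! ### A point blowing-up in prescribed coordinates -/

section BlowupCharts

theorem AnalyticAt.differentiableAt_axis {f : ℝ × ℝ → ℝ} (hf : AnalyticAt ℝ f 0) :
    DifferentiableAt ℝ (fun x : ℝ => f (x, 0)) 0 :=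
  DifferentiableAt.fun_comp' (g := f) (f := fun x : ℝ => ((x, 0) : ℝ × ℝ)) 0 hf.differentiableAt
    (by fun_prop)

theorem planeMap_det_ne_zero_of_equiv {a b c d : ℝ} {L : (ℝ × ℝ) ≃L[ℝ] ℝ × ℝ}
    (h : (L : ℝ × ℝ →L[ℝ] ℝ × ℝ) = planeMap a b c d) : a * d - b * c ≠ 0 := by
  rw [← planeMap_det, ← h]
  exact (LinearEquiv.isUnit_det' L.toLinearEquiv).ne_zero

variable {M : Type*} [TopologicalSpace M] [ChartedSpace (ℝ × ℝ) M]

/-- In suitable coordinates of the blown up surface, the composition of `(x, y) ↦ (x, x (y + y₀))`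
with an analytic isomorphism is again a standard chart of the blowing-up. -/
theorem IsCoordGerm.exists_blowup_form [IsManifold 𝓘(ℝ, ℝ × ℝ) ω M] {χ : M → ℝ × ℝ} {q : M}
    (hχ : IsCoordGerm χ q) {g : ℝ × ℝ → ℝ × ℝ} {L : (ℝ × ℝ) ≃L[ℝ] ℝ × ℝ} (hg : AnalyticAt ℝ g 0)
    (hg0 : g 0 = 0) (hL : HasFDerivAt g (L : ℝ × ℝ →L[ℝ] ℝ × ℝ) 0) (y₀ : ℝ) :
    ∃ X : M → ℝ × ℝ, IsCoordGerm X q ∧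
      ((∃ y₁ : ℝ, ∀ᶠ p in 𝓝 q, g ((χ p).1, (χ p).1 * ((χ p).2 + y₀)) =
        ((X p).1, (X p).1 * ((X p).2 + y₁))) ∨
      ∀ᶠ p in 𝓝 q, g ((χ p).1, (χ p).1 * ((χ p).2 + y₀)) = ((X p).1 * (X p).2, (X p).2)) := by
  obtain ⟨A, hA, hgA⟩ := hg.exists_eq_add_apply
  have hLA : (L : ℝ × ℝ →L[ℝ] ℝ × ℝ) = A 0 := by
    have h1 := (hA.differentiableAt.hasFDerivAt).clm_apply (hasFDerivAt_id (0 : ℝ × ℝ))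
    refine hL.unique ((h1.congr_of_eventuallyEq (f₁ := g) ?_).congr_fderiv ?_)
    · filter_upwards [hgA] with z hz
      simpa [hg0] using hz
    · ext <;> simp
  obtain ⟨a, b, c, d, hA0⟩ : ∃ a b c d, A 0 = planeMap a b c d := ⟨_, _, _, _, eq_planeMap _⟩
  have hdet : a * d - b * c ≠ 0 := planeMap_det_ne_zero_of_equiv (hLA.trans hA0)
  -- By Hadamard the composite is `x * G`, and on the exceptional curve `G (0, y)` is the image of
  -- the direction `(1, y + y₀)` under the differential of `g`.
  set G : ℝ × ℝ → ℝ × ℝ := fun z => A (z.1, z.1 * (z.2 + y₀)) (1, z.2 + y₀) with hG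
  have hσ : AnalyticAt ℝ (fun z : ℝ × ℝ => (z.1, z.1 * (z.2 + y₀))) 0 := by
    apply ContDiffAt.analyticAt (by fun_prop)
  have hσ0 : (((0 : ℝ × ℝ).1, (0 : ℝ × ℝ).1 * ((0 : ℝ × ℝ).2 + y₀)) : ℝ × ℝ) = 0 := by simp
  have hGan : AnalyticAt ℝ G 0 := by
    have h1 : ContDiffAt ℝ ω (fun z : ℝ × ℝ => A (z.1, z.1 * (z.2 + y₀))) 0 :=
      (AnalyticAt.comp (by rw [hσ0]; exact hA) hσ).contDiffAt
    have h2 : ContDiffAt ℝ ω (fun z : ℝ × ℝ => ((1 : ℝ), z.2 + y₀)) 0 := by fun_prop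
    exact (h1.clm_apply h2).analyticAt
  have hG0 : ∀ y, G (0, y) = (a + b * (y + y₀), c + d * (y + y₀)) := by
    intro y
    have : ((0 : ℝ), (0 : ℝ)) = 0 := rfl
    simp [hG, this, hA0]
  have hgG : ∀ᶠ z in 𝓝 (0 : ℝ × ℝ), g (z.1, z.1 * (z.2 + y₀)) = (z.1 * (G z).1, z.1 * (G z).2) := by
    have : Tendsto (fun z : ℝ × ℝ => (z.1, z.1 * (z.2 + y₀))) (𝓝 0) (𝓝 0) := by
      have := hσ.continuousAt.tendsto
      rwa [hσ0] at this
    filter_upwards [this.eventually hgA] with z hz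
    rw [hz, hg0, zero_add]
    have : ((z.1, z.1 * (z.2 + y₀)) : ℝ × ℝ) = z.1 • ((1 : ℝ), z.2 + y₀) := by simp
    conv_lhs => rw [this]
    rw [map_smul, ← this]
    rfl
  have hG1 : AnalyticAt ℝ (fun z => (G z).1) 0 := hGan.contDiffAt.fst.analyticAt
  have hG2 : AnalyticAt ℝ (fun z => (G z).2) 0 := hGan.contDiffAt.snd.analyticAt
  have hz : G 0 = (a + b * y₀, c + d * y₀) := by
    have : G 0 = _ := hG0 0
    simpa using this
  have daff : ∀ r s : ℝ, HasDerivAt (fun y : ℝ => r + s * (y + y₀)) s 0 := fun r s => by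
    simpa using ((hasDerivAt_id (0 : ℝ)).add_const y₀).const_mul s |>.const_add r
  -- The image direction is vertical exactly when its first component vanishes; this selects the
  -- second chart. The slope or its inverse, a Möbius function of `y` on the curve, gives the new
  -- fibre coordinate, and its derivative has numerator `± (a * d - b * c)`.
  by_cases h0 : a + b * y₀ = 0
  · have h2 : c + d * y₀ ≠ 0 := by
      intro h2
      exact hdet (by linear_combination d * h0 - b * h2)
    set F : ℝ × ℝ → ℝ × ℝ := fun z => ((G z).1 / (G z).2, z.1 * (G z).2) with hF
    have hFan : AnalyticAt ℝ F 0 := by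
      exact (hG1.div hG2 (by simpa [hz])).prod (analyticAt_fst.mul hG2)
    have hF0 : F 0 = 0 := by simp [hF, hz, h0]
    refine ⟨F ∘ χ, ?_, Or.inr ?_⟩
    · refine hχ.comp_of_partials hFan hF0 (a := deriv (fun x => (F (x, 0)).1) 0)
        (b := (b * (c + d * (0 + y₀)) - (a + b * (0 + y₀)) * d) / (c + d * (0 + y₀)) ^ 2)
        (c := c + d * y₀) (d := 0) ?_ ?_ ?_ ?_ ?_
      · exact hFan.contDiffAt.fst.analyticAt.differentiableAt_axis.hasDerivAt
      · simp only [hF, hG0]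
        exact (daff a b).div (daff c d) (by simpa)
      · have h3 : HasDerivAt (fun x : ℝ => (G (x, 0)).2)
          (deriv (fun x : ℝ => (G (x, 0)).2) 0) 0 :=
          hG2.differentiableAt_axis.hasDerivAt
        simpa [hG0] using (hasDerivAt_id' (0 : ℝ)).fun_mul h3
      · simpa [hF] using hasDerivAt_const (0 : ℝ) (0 : ℝ)
      · simp [h0, h2]
        intro h
        exact hdet (by linear_combination d * h0 - (d * y₀ + c) * h)
    · filter_upwards [hχ.tendsto.eventually hgG, hχ.tendsto.eventually
        (hG2.continuousAt.eventually_ne (by simpa [hz]))] with p hp hp'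
      rw [hp]
      simp only [hF, Function.comp]
      ext
      · simp; field_simp
      · simp
  · set F : ℝ × ℝ → ℝ × ℝ := fun z =>
      (z.1 * (G z).1, (G z).2 / (G z).1 - (c + d * y₀) / (a + b * y₀)) with hF
    have hFan : AnalyticAt ℝ F 0 := by
      exact (analyticAt_fst.mul hG1).prod ((hG2.div hG1 (by simpa [hz])).sub analyticAt_const)
    have hF0 : F 0 = 0 := by simp [hF, hz]
    refine ⟨F ∘ χ, ?_, Or.inl ⟨(c + d * y₀) / (a + b * y₀), ?_⟩⟩
    · refine hχ.comp_of_partials hFan hF0 (c := deriv (fun x => (F (x, 0)).2) 0)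
        (d := (d * (a + b * (0 + y₀)) - (c + d * (0 + y₀)) * b) / (a + b * (0 + y₀)) ^ 2)
        (a := a + b * y₀) (b := 0) ?_ ?_ ?_ ?_ ?_
      · have h3 : HasDerivAt (fun x : ℝ => (G (x, 0)).1)
          (deriv (fun x : ℝ => (G (x, 0)).1) 0) 0 :=
          hG1.differentiableAt_axis.hasDerivAt
        simpa [hG0] using (hasDerivAt_id' (0 : ℝ)).fun_mul h3
      · simpa [hF] using hasDerivAt_const (0 : ℝ) (0 : ℝ)
      · exact hFan.contDiffAt.snd.analyticAt.differentiableAt_axis.hasDerivAt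
      · simp only [hF, hG0]
        exact ((daff c d).div (daff a b) (by simpa)).sub_const _
      · simp [h0]
        intro h
        apply hdet
        linear_combination h
    · filter_upwards [hχ.tendsto.eventually hgG, hχ.tendsto.eventually
        (hG1.continuousAt.eventually_ne (by simpa [hz]))] with p hp hp'
      rw [hp]
      simp only [hF, Function.comp]
      ext
      · simp
      · simp; field_simp

/-- The two standard charts, at the points of the exceptional curve, in coordinates at the center
chosen beforehand. -/
theorem IsPointBlowup.exists_form {M₁ : Type*} [TopologicalSpace M₁] [ChartedSpace (ℝ × ℝ) M₁]
    [IsManifold 𝓘(ℝ, ℝ × ℝ) ω M] [IsManifold 𝓘(ℝ, ℝ × ℝ) ω M₁] {γ : M₁ → M} {p : M}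
    (hγ : IsPointBlowup γ p) {ψ : M → ℝ × ℝ} (hψ : IsCoordGerm ψ p) {q : M₁} (hq : γ q = p) :
    ∃ X : M₁ → ℝ × ℝ, IsCoordGerm X q ∧
      ((∃ y₁ : ℝ, ∀ᶠ x in 𝓝 q, ψ (γ x) = ((X x).1, (X x).1 * ((X x).2 + y₁))) ∨
      ∀ᶠ x in 𝓝 q, ψ (γ x) = ((X x).1 * (X x).2, (X x).2)) := by
  have hcont : ContinuousAt γ q := hγ.analytic.continuous.continuousAt
  subst hq
  obtain ⟨c, c₁, c₂, hc, hc₁, hc₂, hcov, -, -, h₁, h₂, -, -⟩ := hγ.charts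
  obtain ⟨g, L, hg, hg0, hL, hgc⟩ := hψ.exists_transition hc
  have hgγ := hcont.eventually hgc
  have hqU : q ∈ c₁.source ∪ c₂.source := by rw [← hcov]; exact hc.mem_source
  rcases hqU with hq | hq
  · have h0 : (c₁ q).1 = 0 := by
      have := h₁ q hq
      rw [hc.map_center] at this
      simpa using (congrArg Prod.fst this).symm
    obtain ⟨X, hX, h⟩ := (isCoordGerm_sub_of_mem_maximalAtlas hc₁ hq).exists_blowup_form
      hg hg0 hL (c₁ q).2
    have e : ∀ᶠ x in 𝓝 q, ψ (γ x) = g ((c₁ x - c₁ q).1, (c₁ x - c₁ q).1 *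
        ((c₁ x - c₁ q).2 + (c₁ q).2)) := by
      filter_upwards [hgγ, c₁.open_source.mem_nhds hq] with x hx hx'
      rw [hx, Function.comp, h₁ x hx']
      simp [h0]
    refine ⟨X, hX, h.imp (fun ⟨y₁, h⟩ => ⟨y₁, ?_⟩) fun h => ?_⟩
    all_goals
      filter_upwards [e, h] with x hx hx'
      rw [hx, hx']
  · have h0 : (c₂ q).2 = 0 := by
      have := h₂ q hq
      rw [hc.map_center] at this
      simpa using (congrArg Prod.snd this).symm
    -- Swapping the factors turns the second chart into the first, with `g ∘ S` in place of `g`.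
    let S : (ℝ × ℝ) ≃L[ℝ] ℝ × ℝ := ContinuousLinearEquiv.prodComm ℝ ℝ ℝ
    have hS : ∀ z : ℝ × ℝ, S z = (z.2, z.1) := fun z => rfl
    have hSan : ∀ z, AnalyticAt ℝ S z := fun z => S.analyticAt z
    have hχ := (isCoordGerm_sub_of_mem_maximalAtlas hc₂ hq).comp_analytic (hSan 0) (map_zero S)
      S.hasFDerivAt
    obtain ⟨X, hX, h⟩ := hχ.exists_blowup_form (g := g ∘ S) (L := S.trans L)
      (AnalyticAt.comp (by simpa using hg) (hSan 0)) (by simp [hg0])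
      (HasFDerivAt.comp 0 (by simpa using hL) S.hasFDerivAt) (c₂ q).1
    have e : ∀ᶠ x in 𝓝 q, ψ (γ x) = (g ∘ S) (((S ∘ fun x => c₂ x - c₂ q) x).1,
        ((S ∘ fun x => c₂ x - c₂ q) x).1 * (((S ∘ fun x => c₂ x - c₂ q) x).2 + (c₂ q).1)) := by
      filter_upwards [hgγ, c₂.open_source.mem_nhds hq] with x hx hx'
      rw [hx, Function.comp, h₂ x hx']
      simp [h0, hS, mul_comm]
    refine ⟨X, hX, h.imp (fun ⟨y₁, h⟩ => ⟨y₁, ?_⟩) fun h => ?_⟩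
    all_goals
      filter_upwards [e, h] with x hx hx'
      rw [hx, hx']

end BlowupCharts

/-! ### Stability of the normal forms under blowing up -/

section NormalForms

/-- The normal form of `π` at a point of exactly one component of the exceptional divisor. -/
def HasAxisForm {M : Type*} [TopologicalSpace M] [ChartedSpace (ℝ × ℝ) M] (π : M → ℝ × ℝ) (a : M) :
    Prop :=
  ∃ X : M → ℝ × ℝ, IsCoordGerm X a ∧ ∃ (l m : ℕ) (θ α β : ℝ) (φ : ℝ → ℝ), 0 < l ∧ l ≤ m ∧
    (α = 1 ∨ α = -1) ∧ (β = 1 ∨ β = -1) ∧ AnalyticAt ℝ φ 0 ∧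
    ∀ᶠ q in 𝓝 a, planeRotation θ (π q) =
      (α * (X q).1 ^ l, (X q).1 ^ l * φ (X q).1 + β * (X q).1 ^ m * (X q).2)

/-- The normal form of `π` at a point of two components of the exceptional divisor; the exponents
`l` and `m` are `k * e` and `j * e`. -/
def HasCrossForm {M : Type*} [TopologicalSpace M] [ChartedSpace (ℝ × ℝ) M] (π : M → ℝ × ℝ) (a : M) :
    Prop :=
  ∃ X : M → ℝ × ℝ, IsCoordGerm X a ∧ ∃ (k j e n p : ℕ) (θ α β : ℝ) (h : ℝ → ℝ),
    0 < k ∧ 0 < j ∧ 0 < e ∧ k * e ≤ n ∧ j * e ≤ p ∧ (k : ℝ) * p - j * n ≠ 0 ∧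
    (α = 1 ∨ α = -1) ∧ (β = 1 ∨ β = -1) ∧ AnalyticAt ℝ h 0 ∧
    ∀ᶠ q in 𝓝 a, planeRotation θ (π q) =
      (α * ((X q).1 ^ k * (X q).2 ^ j) ^ e,
        ((X q).1 ^ k * (X q).2 ^ j) ^ e * h ((X q).1 ^ k * (X q).2 ^ j) +
          β * ((X q).1 ^ n * (X q).2 ^ p))

variable {M N : Type*} [TopologicalSpace M] [ChartedSpace (ℝ × ℝ) M]
  [IsManifold 𝓘(ℝ, ℝ × ℝ) ω M] [TopologicalSpace N] [ChartedSpace (ℝ × ℝ) N]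
  [IsManifold 𝓘(ℝ, ℝ × ℝ) ω N] {π : M → ℝ × ℝ} {γ : N → M} {q : N}

theorem HasAxisForm.comp_localDiffeo (h : HasAxisForm π (γ q))
    (hγ : IsLocalDiffeomorphAt 𝓘(ℝ, ℝ × ℝ) 𝓘(ℝ, ℝ × ℝ) ω γ q) : HasAxisForm (π ∘ γ) q := by
  obtain ⟨X, hX, l, m, θ, α, β, φ, hl, hm, hα, hβ, hφ, e⟩ := h
  exact ⟨X ∘ γ, hX.comp_localDiffeo hγ, l, m, θ, α, β, φ, hl, hm, hα, hβ, hφ,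
    hγ.contMDiffAt.continuousAt.eventually e⟩

theorem HasCrossForm.comp_localDiffeo (h : HasCrossForm π (γ q))
    (hγ : IsLocalDiffeomorphAt 𝓘(ℝ, ℝ × ℝ) 𝓘(ℝ, ℝ × ℝ) ω γ q) : HasCrossForm (π ∘ γ) q := by
  obtain ⟨X, hX, k, j, e, n, p, θ, α, β, φ, hk, hj, he, hn, hp, hd, hα, hβ, hφ, ev⟩ := h
  exact ⟨X ∘ γ, hX.comp_localDiffeo hγ, k, j, e, n, p, θ, α, β, φ, hk, hj, he, hn, hp, hd, hα, hβ,
    hφ, hγ.contMDiffAt.continuousAt.eventually ev⟩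

theorem IsPointBlowup.hasAxisForm_origin {γ : N → ℝ × ℝ} (hγ : IsPointBlowup γ 0) (hq : γ q = 0) :
    HasAxisForm γ q := by
  have hid : IsCoordGerm (id : ℝ × ℝ → ℝ × ℝ) 0 :=
    ⟨OpenPartialHomeomorph.refl _, ⟨StructureGroupoid.id_mem_maximalAtlas _, by simp, by simp⟩,
      Eventually.of_forall fun _ => rfl⟩
  obtain ⟨X, hX, ⟨y, h⟩ | h⟩ := hγ.exists_form hid hq
  · refine ⟨X, hX, 1, 1, 0, 1, 1, fun _ => y, one_pos, le_rfl, Or.inl rfl, Or.inl rfl,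
      analyticAt_const, ?_⟩
    filter_upwards [h] with x hx
    simp only [id] at hx
    rw [hx]
    ext <;> simp [planeRotation]
    ring
  · have hX' : IsCoordGerm ((fun z => (z.2, z.1)) ∘ X) q := by
      refine hX.comp_of_partials (F := fun z => (z.2, z.1)) (a := 0) (b := 1) (c := 1) (d := 0)
        (ContDiffAt.analyticAt (by fun_prop)) rfl ?_ ?_ ?_ ?_ (by simp)
      · exact hasDerivAt_const _ _
      · exact hasDerivAt_id _
      · exact hasDerivAt_id _
      · exact hasDerivAt_const _ _
    -- The quarter turn sends `(x * y, y)` to `(y, -(x * y))`, an axis form in the swapped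
    -- coordinates. Only here is a nontrivial rotation introduced.
    refine ⟨_, hX', 1, 1, -(Real.pi / 2), 1, -1, fun _ => 0, one_pos, le_rfl, Or.inl rfl,
      Or.inr rfl, analyticAt_const, ?_⟩
    filter_upwards [h] with x hx
    simp only [id] at hx
    rw [hx]
    ext <;> simp [planeRotation]
    ring

theorem HasAxisForm.blowup {p : M} (h : HasAxisForm π p) (hγ : IsPointBlowup γ p) (hq : γ q = p) :
    HasAxisForm (π ∘ γ) q ∨ HasCrossForm (π ∘ γ) q := by
  obtain ⟨X, hX, l, m, θ, α, β, φ, hl, hm, hα, hβ, hφ, ev⟩ := h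
  have hev := hγ.analytic.continuous.continuousAt.eventually (hq ▸ ev)
  obtain ⟨Y, hY, ⟨y, h⟩ | h⟩ := hγ.exists_form hX hq
  -- The term `β * y * x ^ (m + 1)` depends on `x` alone and is divisible by `x ^ l`, so it joins
  -- `φ`.
  · refine Or.inl ⟨Y, hY, l, m + 1, θ, α, β, fun t => φ t + β * y * t ^ (m + 1 - l), hl, by omega,
      hα, hβ, hφ.add (analyticAt_const.mul (analyticAt_id.pow _)), ?_⟩
    filter_upwards [hev, h] with x hx hx'
    rw [Function.comp, hx, hx']
    ext
    · rfl
    · have : (Y x).1 ^ (m + 1) = (Y x).1 ^ l * (Y x).1 ^ (m + 1 - l) := by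
        rw [← pow_add]; congr 1; omega
      simp only
      linear_combination (β * y) * this
  · refine Or.inr ⟨Y, hY, 1, 1, l, m, m + 1, θ, α, β, φ, one_pos, one_pos, hl, by omega, by omega,
      by simp, hα, hβ, hφ, ?_⟩
    filter_upwards [hev, h] with x hx hx'
    rw [Function.comp, hx, hx']
    ext
    · simp
    · simp; ring

theorem HasCrossForm.blowup {p : M} (h : HasCrossForm π p) (hγ : IsPointBlowup γ p)
    (hq : γ q = p) : HasAxisForm (π ∘ γ) q ∨ HasCrossForm (π ∘ γ) q := by
  obtain ⟨X, hX, k, j, e, n, p', θ, α, β, φ, hk, hj, he, hn, hp, hd, hα, hβ, hφ, ev⟩ := h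
  have hev := hγ.analytic.continuous.continuousAt.eventually (hq ▸ ev)
  obtain ⟨Y, hY, ⟨y, h⟩ | h⟩ := hγ.exists_form hX hq
  · by_cases hy : y = 0
    · refine Or.inr ⟨Y, hY, k + j, j, e, n + p', p', θ, α, β, φ, by omega, hj, he, by nlinarith,
        hp, by push_cast; convert hd using 1; ring, hα, hβ, hφ, ?_⟩
      filter_upwards [hev, h] with x hx hx'
      rw [Function.comp, hx, hx', hy]
      have h1 : (Y x).1 ^ k * ((Y x).1 * ((Y x).2 + 0)) ^ j = (Y x).1 ^ (k + j) * (Y x).2 ^ j := by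
        ring
      have h2 : (Y x).1 ^ n * ((Y x).1 * ((Y x).2 + 0)) ^ p' =
        (Y x).1 ^ (n + p') * (Y x).2 ^ p' := by ring
      simp only [h1, h2]
    · left
      -- `ρ` is the sign of `y`; real powers are taken of `ρ * (t + y)`, which is positive near `t =
      -- 0`.
      obtain ⟨ρ, hρ, hρy⟩ : ∃ ρ : ℝ, (ρ = 1 ∨ ρ = -1) ∧ 0 < ρ * y := by
        rcases lt_or_gt_of_ne hy with h | h
        · exact ⟨-1, Or.inr rfl, by linarith⟩
        · exact ⟨1, Or.inl rfl, by linarith⟩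
      have hρ2 : ρ * ρ = 1 := by rcases hρ with rfl | rfl <;> norm_num
      have hρpow : ∀ i : ℕ, ρ ^ i = 1 ∨ ρ ^ i = -1 := by
        intro i
        rcases hρ with rfl | rfl
        · simp
        · exact neg_one_pow_eq_or ℝ i
      have hsign : ∀ {r s : ℝ}, (r = 1 ∨ r = -1) → (s = 1 ∨ s = -1) → (r * s = 1 ∨ r * s = -1) := by
        rintro r s (rfl | rfl) (rfl | rfl) <;> norm_num
      have hkj : (k : ℝ) + j ≠ 0 := by positivity
      -- `κ` solves `κ * (k + j) = j`, so `s = ρ ^ j * T ^ (k + j)` for `T = x * |t + y| ^ κ`. Then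
      -- `δ = p' - κ * (n + p')` is the power of `|t + y|` left over in `u ^ n * v ^ p'`.
      set κ : ℝ := j / (k + j) with hκ
      set δ : ℝ := (k * p' - j * n) / (k + j) with hδ
      have hδ0 : δ ≠ 0 := div_ne_zero hd hkj
      set w : ℝ → ℝ := fun t => Real.log (ρ * (t + y)) with hw
      have hwan : AnalyticAt ℝ (fun z : ℝ × ℝ => w z.2) 0 :=
        ContDiffAt.analyticAt (ContDiffAt.log (by fun_prop) (by simpa using hρy.ne'))
      have hw' : HasDerivAt w y⁻¹ 0 := by
        have h1 : HasDerivAt (fun t : ℝ => ρ * (t + y)) ρ 0 := by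
          simpa using ((hasDerivAt_id' (0 : ℝ)).add_const y).const_mul ρ
        convert h1.log (by simpa using hρy.ne') using 1
        have : ρ ≠ 0 := by rintro rfl; simp at hρy
        simp only [zero_add]
        field_simp
      set c₀ := Real.exp (δ * w 0) with hc₀
      set F : ℝ × ℝ → ℝ × ℝ := fun z =>
        (z.1 * Real.exp (κ * w z.2), Real.exp (δ * w z.2) - c₀) with hF
      have hFY : IsCoordGerm (F ∘ Y) q := by
        refine hY.comp_of_partials (a := Real.exp (κ * w 0)) (b := 0) (c := 0)
          (d := c₀ * (δ * y⁻¹)) ?_ ?_ ?_ ?_ ?_ ?_ ?_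
        · exact (analyticAt_fst.mul ((analyticAt_const.mul hwan).rexp')).prod
            (((analyticAt_const.mul hwan).rexp').sub analyticAt_const)
        · simp [hF, hc₀]
        · simpa using (hasDerivAt_id' (0 : ℝ)).mul_const (Real.exp (κ * w 0))
        · simpa [hF] using hasDerivAt_const (0 : ℝ) (0 : ℝ)
        · simpa [hF] using hasDerivAt_const (0 : ℝ) _
        · exact ((hw'.const_mul δ).exp).sub_const _
        · simp [hδ0, hy, hc₀]
      -- The second coordinate is recentered by `c₀`; the resulting pure power of `T` goes into the
      -- new `φ`.
      refine ⟨_, hFY, (k + j) * e, n + p', θ, α * (ρ ^ j) ^ e, β * ρ ^ p',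
        fun t => (ρ ^ j) ^ e * φ (ρ ^ j * t ^ (k + j)) +
          β * ρ ^ p' * c₀ * t ^ (n + p' - (k + j) * e), by positivity, by nlinarith,
        hsign hα (by rw [← pow_mul]; exact hρpow _), hsign hβ (hρpow _), ?_, ?_⟩
      · refine AnalyticAt.add (analyticAt_const.mul ?_)
          (analyticAt_const.mul (analyticAt_id.pow _))
        refine AnalyticAt.fun_comp (g := φ) ?_ (analyticAt_const.mul (analyticAt_id.pow _))
        have : k + j ≠ 0 := by omega
        have h0 : ρ ^ j * (0 : ℝ) ^ (k + j) = 0 := by rw [zero_pow this, mul_zero]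
        change AnalyticAt ℝ φ (ρ ^ j * (0 : ℝ) ^ (k + j))
        rw [h0]
        exact hφ
      · have hpos : ∀ᶠ x in 𝓝 q, 0 < ρ * ((Y x).2 + y) := by
          have : Tendsto (fun x => ρ * ((Y x).2 + y)) (𝓝 q) (𝓝 (ρ * ((0 : ℝ × ℝ).2 + y))) :=
            ((hY.tendsto.snd_nhds).add_const y).const_mul ρ
          exact this.eventually (lt_mem_nhds (by simpa using hρy))
        filter_upwards [hev, h, hpos] with x hx hx' hx''
        rw [Function.comp, hx, hx']
        have hexp : Real.exp (w (Y x).2) = ρ * ((Y x).2 + y) := Real.exp_log hx''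
        have hs : (Y x).2 + y = ρ * Real.exp (w (Y x).2) := by
          rw [hexp]; linear_combination (-((Y x).2 + y)) * hρ2
        have e1 : Real.exp (κ * w (Y x).2) ^ (k + j) = Real.exp (w (Y x).2) ^ j := by
          rw [← Real.exp_nat_mul, ← Real.exp_nat_mul]
          congr 1
          rw [hκ]; push_cast; field_simp
        have e2 : Real.exp (κ * w (Y x).2) ^ (n + p') * Real.exp (δ * w (Y x).2) =
            Real.exp (w (Y x).2) ^ p' := by
          rw [← Real.exp_nat_mul, ← Real.exp_nat_mul, ← Real.exp_add]
          congr 1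
          rw [hκ, hδ]; push_cast; field_simp; ring
        have hFx : (F ∘ Y) x = ((Y x).1 * Real.exp (κ * w (Y x).2), Real.exp (δ * w (Y x).2) - c₀) :=
          rfl
        rw [hFx]
        generalize w (Y x).2 = W at *
        have h1 : (Y x).1 ^ k * ((Y x).1 * ((Y x).2 + y)) ^ j =
            ρ ^ j * ((Y x).1 * Real.exp (κ * W)) ^ (k + j) := by
          rw [hs, mul_pow _ (Real.exp (κ * W)), e1]; ring
        have h2 : (Y x).1 ^ n * ((Y x).1 * ((Y x).2 + y)) ^ p' =
            ρ ^ p' * (((Y x).1 * Real.exp (κ * W)) ^ (n + p') * Real.exp (δ * W)) := by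
          rw [hs, mul_pow _ (Real.exp (κ * W)), mul_assoc (_ ^ (n + p')), e2]; ring
        have h3 : ((Y x).1 * Real.exp (κ * W)) ^ (n + p') =
            ((Y x).1 * Real.exp (κ * W)) ^ ((k + j) * e) *
              ((Y x).1 * Real.exp (κ * W)) ^ (n + p' - (k + j) * e) := by
          rw [← pow_add]; congr 1
          have : (k + j) * e ≤ n + p' := by nlinarith
          omega
        simp only [h1, h2]
        generalize (Y x).1 * Real.exp (κ * W) = T at *
        ext
        · simp only; ring
        · simp only; rw [h3]; ring
  · refine Or.inr ⟨Y, hY, k, k + j, e, n, n + p', θ, α, β, φ, hk, by omega, he, hn, by nlinarith,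
      by push_cast; convert hd using 1; ring, hα, hβ, hφ, ?_⟩
    filter_upwards [hev, h] with x hx hx'
    rw [Function.comp, hx, hx']
    have h1 : ((Y x).1 * (Y x).2) ^ k * (Y x).2 ^ j = (Y x).1 ^ k * (Y x).2 ^ (k + j) := by
      ring
    have h2 : ((Y x).1 * (Y x).2) ^ n * (Y x).2 ^ p' = (Y x).1 ^ n * (Y x).2 ^ (n + p') := by ring
    simp only [h1, h2]

theorem IsBlowupComposition.hasForm {M : Type u} [TopologicalSpace M] [ChartedSpace (ℝ × ℝ) M]
    {π : M → ℝ × ℝ} (hπ : IsBlowupComposition π) :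
    ∀ a ∈ exceptionalDivisor π, HasAxisForm π a ∨ HasCrossForm π a := by
  induction hπ with
  | origin γ hγ => exact fun a ha => Or.inl (hγ.hasAxisForm_origin ha)
  | step π _ p hp γ hγ ih =>
    intro a ha
    by_cases h : γ a = p
    · rcases ih p hp with h' | h'
      · exact h'.blowup hγ h
      · exact h'.blowup hγ h
    · exact (ih (γ a) ha).imp (fun h' => h'.comp_localDiffeo (hγ.localIso a h))
        fun h' => h'.comp_localDiffeo (hγ.localIso a h)

end NormalForms

/-! ### Rotations and determinants -/

section Rotation

theorem planeRotation_eq_planeMap (θ : ℝ) (z : ℝ × ℝ) :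
    planeRotation θ z = planeMap (Real.cos θ) (-Real.sin θ) (Real.sin θ) (Real.cos θ) z := by
  simp [planeRotation, sub_eq_add_neg]

theorem planeRotation_neg_planeRotation (θ : ℝ) (z : ℝ × ℝ) :
    planeRotation (-θ) (planeRotation θ z) = z := by
  have h := Real.sin_sq_add_cos_sq θ
  ext
  · simp [planeRotation]; linear_combination z.1 * h
  · simp [planeRotation]; linear_combination z.2 * h

theorem planeRotation_zero (θ : ℝ) : planeRotation θ 0 = 0 := by simp [planeRotation]

theorem planeRotation_eq_zero_iff {θ : ℝ} {z : ℝ × ℝ} : planeRotation θ z = 0 ↔ z = 0 := by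
  refine ⟨fun h => ?_, fun h => h ▸ planeRotation_zero θ⟩
  rw [← planeRotation_neg_planeRotation θ z, h, planeRotation_zero]

theorem planeRotation_funext (θ : ℝ) : planeRotation θ =
    planeMap (Real.cos θ) (-Real.sin θ) (Real.sin θ) (Real.cos θ) :=
  funext (planeRotation_eq_planeMap θ)

theorem planeRotation_det (θ : ℝ) :
    (planeMap (Real.cos θ) (-Real.sin θ) (Real.sin θ) (Real.cos θ)).det = 1 := by
  rw [planeMap_det]
  linear_combination Real.sin_sq_add_cos_sq θ

theorem det_eq (L : ℝ × ℝ →L[ℝ] ℝ × ℝ) :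
    L.det = (L (1, 0)).1 * (L (0, 1)).2 - (L (0, 1)).1 * (L (1, 0)).2 := by
  conv_lhs => rw [eq_planeMap L]
  exact planeMap_det _ _ _ _

theorem det_comp (A B : ℝ × ℝ →L[ℝ] ℝ × ℝ) : (A.comp B).det = A.det * B.det :=
  LinearMap.det_comp _ _

end Rotation

/-! ### Ideals and corner points read off the normal forms -/

section IdealsOfForms

variable {M : Type*} [TopologicalSpace M] [ChartedSpace (ℝ × ℝ) M]

theorem germIdeal_eq_singleton {a : M} {S : Set (M → ℝ)} {g : M → ℝ}
    (hg : ContMDiffAt 𝓘(ℝ, ℝ × ℝ) 𝓘(ℝ, ℝ) ω g a)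
    (hle : ∀ f ∈ S, ∃ c : M → ℝ, ContMDiffAt 𝓘(ℝ, ℝ × ℝ) 𝓘(ℝ, ℝ) ω c a ∧
      ∀ᶠ q in 𝓝 a, f q = c q * g q)
    (hge : ∃ f ∈ S, ∃ c : ℝ, ∀ᶠ q in 𝓝 a, f q = c * g q ∧ c ≠ 0) :
    germIdeal a S = germIdeal a {g} := by
  have key : ∀ {T : Set (M → ℝ)} {f : M → ℝ} (_ : f ∈ T)
      (hf : ContMDiffAt 𝓘(ℝ, ℝ × ℝ) 𝓘(ℝ, ℝ) ω f a) {x : analyticGerms a} {c : M → ℝ}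
      (_ : ContMDiffAt 𝓘(ℝ, ℝ × ℝ) 𝓘(ℝ, ℝ) ω c a)
      (_ : (x : Germ (𝓝 a) ℝ) = ((c * f : M → ℝ) : Germ (𝓝 a) ℝ)), x ∈ germIdeal a T := by
    intro T f hfT hf x c hc hx
    have : x = (⟨_, c, hc, rfl⟩ : analyticGerms a) * ⟨_, f, hf, rfl⟩ := Subtype.ext hx
    rw [this]
    exact Ideal.mul_mem_left _ _ (Ideal.subset_span ⟨f, hfT, rfl⟩)
  apply le_antisymm
  · refine Ideal.span_le.2 ?_
    rintro x ⟨f, hf, hx⟩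
    obtain ⟨c, hc, h⟩ := hle f hf
    exact key (Set.mem_singleton g) hg hc (hx.trans (Germ.coe_eq.2 h))
  · refine Ideal.span_le.2 ?_
    rintro x ⟨_, rfl, hx⟩
    obtain ⟨f, hf, c, h⟩ := hge
    have hf' : ContMDiffAt 𝓘(ℝ, ℝ × ℝ) 𝓘(ℝ, ℝ) ω f a :=
      (contMDiffAt_const (c := c) |>.mul hg).congr_of_eventuallyEq (h.mono fun q hq => hq.1)
    refine key hf hf' (contMDiffAt_const (c := c⁻¹)) (hx.trans (Germ.coe_eq.2 ?_))
    filter_upwards [h] with q hq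
    simp [hq.1, hq.2]

variable [IsManifold 𝓘(ℝ, ℝ × ℝ) ω M]

theorem IsAnalyticCoord.contMDiffAt_comp {ψ : OpenPartialHomeomorph M (ℝ × ℝ)} {a : M}
    (h : IsAnalyticCoord ψ a) {f : ℝ × ℝ → ℝ} (hf : AnalyticAt ℝ f 0) :
    ContMDiffAt 𝓘(ℝ, ℝ × ℝ) 𝓘(ℝ, ℝ) ω (fun q => f (ψ q)) a := by
  refine ContMDiffAt.comp a (g := f) ?_ h.contMDiffAt
  rw [h.map_center]
  exact hf.contDiffAt.contMDiffAt

/-- The rotated map is `w • (α, B)`, so Hadamard makes every pulled-back germ a multiple of `w`; the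
first rotated component is `± w` itself. -/
theorem pullbackIdeal_eq_of_form {π : M → ℝ × ℝ} {a : M} {ψ : OpenPartialHomeomorph M (ℝ × ℝ)}
    (hψ : IsAnalyticCoord ψ a) {θ α : ℝ} (hα : α = 1 ∨ α = -1) {w B : ℝ × ℝ → ℝ}
    (hw : AnalyticAt ℝ w 0) (hw0 : w 0 = 0) (hB : AnalyticAt ℝ B 0)
    (h : ∀ᶠ q in 𝓝 a, planeRotation θ (π q) = (α * w (ψ q), w (ψ q) * B (ψ q))) :
    pullbackIdeal π a = germIdeal a {fun q => w (ψ q)} := by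
  refine germIdeal_eq_singleton (hψ.contMDiffAt_comp hw) ?_ ?_
  · rintro _ ⟨f, hf, hf0, rfl⟩
    set N : ℝ × ℝ → ℝ × ℝ := fun z => (α * w z, w z * B z) with hN
    have hNan : AnalyticAt ℝ N 0 := (analyticAt_const.mul hw).prod (hw.mul hB)
    have hN0 : N 0 = 0 := by simp [hN, hw0]
    have hfR : AnalyticAt ℝ (fun z => f (planeRotation (-θ) z)) 0 := by
      refine AnalyticAt.fun_comp (g := f) (by rwa [planeRotation_zero]) ?_
      rw [planeRotation_funext]
      exact ContinuousLinearMap.analyticAt _ _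
    obtain ⟨A, hA, hfA⟩ := hfR.exists_eq_add_apply
    have hAN : ContDiffAt ℝ ω (fun z => A (N z)) 0 :=
      (AnalyticAt.fun_comp (g := A) (by rwa [hN0]) hNan).contDiffAt
    have hV : ContDiffAt ℝ ω (fun z => ((α, B z) : ℝ × ℝ)) 0 := contDiffAt_const.prodMk hB.contDiffAt
    refine ⟨_, hψ.contMDiffAt_comp (hAN.clm_apply hV).analyticAt, ?_⟩
    have ht : Tendsto (fun q => N (ψ q)) (𝓝 a) (𝓝 0) := by
      have : Tendsto N (𝓝 0) (𝓝 0) := by simpa [hN0] using hNan.continuousAt.tendsto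
      exact this.comp hψ.isCoordGerm.tendsto
    filter_upwards [h, ht.eventually hfA] with q hq hq'
    have e : N (ψ q) = w (ψ q) • ((α, B (ψ q)) : ℝ × ℝ) := by simp [hN, mul_comm]
    rw [Function.comp, ← planeRotation_neg_planeRotation θ (π q), hq, hq', planeRotation_zero, hf0,
      zero_add, mul_comm]
    conv_lhs => rw [e]
    rw [map_smul, ← e, smul_eq_mul]
  · refine ⟨_, ⟨fun z => (planeRotation θ z).1, ?_, by simp [planeRotation], rfl⟩, α, ?_⟩
    · rw [planeRotation_funext]
      exact ((ContinuousLinearMap.analyticAt _ _).contDiffAt.fst).analyticAt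
    · filter_upwards [h] with q hq
      refine ⟨by simp [hq], ?_⟩
      rcases hα with rfl | rfl <;> norm_num

/-- By the chain rule any other chart multiplies the determinant by that of an analytic transition,
while rotations have determinant one; the chart `ψ` itself supplies the generator. -/
theorem jacobianIdeal_eq_of_form {π : M → ℝ × ℝ} {a : M} {ψ : OpenPartialHomeomorph M (ℝ × ℝ)}
    (hψ : IsAnalyticCoord ψ a) {θ κ : ℝ} (hκ : κ ≠ 0) {N : ℝ × ℝ → ℝ × ℝ} {w : ℝ × ℝ → ℝ}
    (hw : AnalyticAt ℝ w 0)
    (hN : ∀ᶠ z in 𝓝 (0 : ℝ × ℝ), ∃ D : ℝ × ℝ →L[ℝ] ℝ × ℝ, HasFDerivAt N D z ∧ D.det = κ * w z)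
    (h : ∀ᶠ q in 𝓝 a, planeRotation θ (π q) = N (ψ q)) :
    jacobianIdeal π a = germIdeal a {fun q => w (ψ q)} := by
  have key : ∀ {χ : OpenPartialHomeomorph M (ℝ × ℝ)}, IsAnalyticCoord χ a →
      ∀ {g : ℝ × ℝ → ℝ × ℝ}, AnalyticAt ℝ g 0 → (∀ᶠ q in 𝓝 a, ψ q = g (χ q)) →
      ∀ᶠ q in 𝓝 a, (fderiv ℝ (π ∘ χ.symm) (χ q)).det =
        (fderiv ℝ g (χ q)).det * κ * w (ψ q) := by
    intro χ hχ g hg hgχ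
    have hgd : ∀ᶠ z in 𝓝 (0 : ℝ × ℝ), DifferentiableAt ℝ g z :=
      hg.eventually_analyticAt.mono fun z hz => hz.differentiableAt
    filter_upwards [h.eventually_nhds, hgχ.eventually_nhds, χ.open_source.mem_nhds hχ.mem_source,
      hψ.isCoordGerm.tendsto.eventually hN, hχ.isCoordGerm.tendsto.eventually hgd]
      with q hq hq' hqs hqN hqg
    obtain ⟨D, hD, hDdet⟩ := hqN
    rw [hq'.self_of_nhds] at hD
    have ht : Tendsto χ.symm (𝓝 (χ q)) (𝓝 q) := χ.tendsto_symm hqs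
    set R := planeMap (Real.cos (-θ)) (-Real.sin (-θ)) (Real.sin (-θ)) (Real.cos (-θ))
    have hder : HasFDerivAt (fun z => R (N (g z))) (R.comp (D.comp (fderiv ℝ g (χ q)))) (χ q) :=
      R.hasFDerivAt.comp _ (hD.comp _ hqg.hasFDerivAt)
    have hev : π ∘ χ.symm =ᶠ[𝓝 (χ q)] fun z => R (N (g z)) := by
      filter_upwards [ht.eventually hq, ht.eventually hq',
        χ.open_target.mem_nhds (χ.map_source hqs)] with z hz hz' hzt
      rw [χ.right_inv hzt] at hz'
      rw [Function.comp, ← planeRotation_neg_planeRotation θ (π (χ.symm z)), hz, hz',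
        planeRotation_eq_planeMap]
    rw [(hder.congr_of_eventuallyEq hev).fderiv, det_comp, det_comp, planeRotation_det, hDdet]
    ring
  refine germIdeal_eq_singleton (hψ.contMDiffAt_comp hw) ?_ ?_
  · rintro _ ⟨χ, hχ, rfl⟩
    obtain ⟨g, L, hg, -, -, hgχ⟩ := hψ.isCoordGerm.exists_transition hχ
    refine ⟨_, hχ.contMDiffAt_comp (f := fun z => (fderiv ℝ g z).det * κ) ?_, key hχ hg hgχ⟩
    have h1 : ContDiffAt ℝ ω (fderiv ℝ g) 0 := hg.fderiv.contDiffAt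
    simp only [det_eq]
    apply ContDiffAt.analyticAt
    fun_prop
  · refine ⟨_, ⟨ψ, hψ, rfl⟩, κ, ?_⟩
    filter_upwards [key hψ analyticAt_id (Eventually.of_forall fun q => rfl)] with q hq
    refine ⟨?_, hκ⟩
    rw [hq, fderiv_id, det_eq]
    simp

/-- At a corner, the first component of `X` would vanish along two transverse axes, so its
differential would be zero, contradicting that `X` is a coordinate system. -/
theorem not_isCornerPoint_of_axis {E : Set M} {a : M} {X : M → ℝ × ℝ} (hX : IsCoordGerm X a)
    (hE : ∀ᶠ q in 𝓝 a, q ∈ E ↔ (X q).1 = 0) : ¬ IsCornerPoint E a := by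
  rintro ⟨χ, hχ, hχE⟩
  obtain ⟨g, L, hg, -, hL, hgχ⟩ := hX.exists_transition hχ
  have h0 : χ.symm 0 = a := by rw [← hχ.map_center, χ.left_inv hχ.mem_source]
  have h0t : (0 : ℝ × ℝ) ∈ χ.target := by rw [← hχ.map_center]; exact χ.map_source hχ.mem_source
  have ht : Tendsto χ.symm (𝓝 0) (𝓝 a) := by
    simpa [h0] using (χ.symm.continuousAt h0t).tendsto
  have hz : ∀ᶠ z in 𝓝 (0 : ℝ × ℝ), z.1 * z.2 = 0 → (g z).1 = 0 := by
    filter_upwards [ht.eventually hE, ht.eventually hχE, ht.eventually hgχ,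
      χ.open_target.mem_nhds h0t] with z h1 h2 h3 hzt h4
    rw [χ.right_inv hzt] at h2
    rw [Function.comp, χ.right_inv hzt] at h3
    rw [← h3]
    exact h1.1 (h2.2 h4)
  have hline : ∀ v : ℝ × ℝ, v.1 * v.2 = 0 → (L v).1 = 0 := by
    intro v hv
    have hd : HasDerivAt (fun t : ℝ => t • v) v 0 := by
      simpa using (hasDerivAt_id' (0 : ℝ)).smul_const v
    have hL' : HasFDerivAt g (L : ℝ × ℝ →L[ℝ] ℝ × ℝ) ((0 : ℝ) • v) := by simpa using hL
    have hgd : HasDerivAt (fun t : ℝ => (g (t • v)).1) (L v).1 0 := by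
      have : HasDerivAt (fun t : ℝ => g (t • v)) (L v) 0 :=
        HasFDerivAt.comp_hasDerivAt (f := fun t : ℝ => t • v) 0 hL' hd
      exact this.fst
    have hev : (fun t : ℝ => (g (t • v)).1) =ᶠ[𝓝 0] fun _ => 0 := by
      have : Tendsto (fun t : ℝ => t • v) (𝓝 0) (𝓝 0) := by
        simpa using hd.continuousAt.tendsto
      filter_upwards [this.eventually hz] with t ht
      apply ht
      simp only [Prod.smul_fst, Prod.smul_snd, smul_eq_mul]
      linear_combination t * t * hv
    exact hgd.unique ((hasDerivAt_const _ _).congr_of_eventuallyEq hev)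
  refine planeMap_det_ne_zero_of_equiv (eq_planeMap (L : ℝ × ℝ →L[ℝ] ℝ × ℝ)) ?_
  have h1 := hline (1, 0) (by simp)
  have h2 := hline (0, 1) (by simp)
  simp [h1, h2]

end IdealsOfForms

/-! ### Divisor and Jacobian determinant of the normal forms -/

section Main

theorem mem_exceptionalDivisor_iff {M : Type*} {π : M → ℝ × ℝ} {θ : ℝ} {q : M} :
    q ∈ exceptionalDivisor π ↔ planeRotation θ (π q) = 0 :=
  planeRotation_eq_zero_iff.symm

theorem eventually_mem_exceptionalDivisor_axis {M : Type*} [TopologicalSpace M]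
    {π : M → ℝ × ℝ} {X : M → ℝ × ℝ} {a : M}
    {l m : ℕ} {θ α β : ℝ} {φ : ℝ → ℝ} (hl : 0 < l) (hm : l ≤ m) (hα : α = 1 ∨ α = -1)
    (h : ∀ᶠ q in 𝓝 a, planeRotation θ (π q) =
      (α * (X q).1 ^ l, (X q).1 ^ l * φ (X q).1 + β * (X q).1 ^ m * (X q).2)) :
    ∀ᶠ q in 𝓝 a, q ∈ exceptionalDivisor π ↔ (X q).1 = 0 := by
  have hα0 : α ≠ 0 := by rcases hα with rfl | rfl <;> norm_num
  filter_upwards [h] with q hq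
  rw [mem_exceptionalDivisor_iff (θ := θ), hq]
  have hl' : l ≠ 0 := by omega
  have hm' : m ≠ 0 := by omega
  constructor
  · intro h
    simpa [hα0, hl'] using congrArg Prod.fst h
  · intro h
    simp [h, hl', hm']

theorem eventually_mem_exceptionalDivisor_cross {M : Type*} [TopologicalSpace M]
    {π : M → ℝ × ℝ} {X : M → ℝ × ℝ} {a : M}
    {k j e n p : ℕ} {θ α β : ℝ} {φ : ℝ → ℝ} (hk : 0 < k) (hj : 0 < j) (he : 0 < e) (hn : 0 < n)
    (hp : 0 < p) (hα : α = 1 ∨ α = -1)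
    (h : ∀ᶠ q in 𝓝 a, planeRotation θ (π q) =
      (α * ((X q).1 ^ k * (X q).2 ^ j) ^ e,
        ((X q).1 ^ k * (X q).2 ^ j) ^ e * φ ((X q).1 ^ k * (X q).2 ^ j) +
          β * ((X q).1 ^ n * (X q).2 ^ p))) :
    ∀ᶠ q in 𝓝 a, q ∈ exceptionalDivisor π ↔ (X q).1 * (X q).2 = 0 := by
  have hα0 : α ≠ 0 := by rcases hα with rfl | rfl <;> norm_num
  filter_upwards [h] with q hq
  rw [mem_exceptionalDivisor_iff (θ := θ), hq]
  constructor
  · intro h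
    simpa [hα0, hk.ne', hj.ne', he.ne'] using congrArg Prod.fst h
  · intro h
    rcases mul_eq_zero.1 h with h | h <;> simp [h, hk.ne', hj.ne', he.ne', hn.ne', hp.ne']

theorem hasFDerivAt_axisForm {l m : ℕ} {α β : ℝ} {φ : ℝ → ℝ} {z : ℝ × ℝ}
    (hl : 0 < l) (hφ : DifferentiableAt ℝ φ z.1) :
    ∃ D : ℝ × ℝ →L[ℝ] ℝ × ℝ,
      HasFDerivAt (fun z : ℝ × ℝ => (α * z.1 ^ l, z.1 ^ l * φ z.1 + β * z.1 ^ m * z.2)) D z ∧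
      D.det = α * β * l * z.1 ^ (l + m - 1) := by
  have h1 : HasFDerivAt (fun z : ℝ × ℝ => α * z.1 ^ l) _ z :=
    HasDerivAt.comp_hasFDerivAt (h₂ := fun t => α * t ^ l) z ((hasDerivAt_pow l z.1).const_mul α) (hasFDerivAt_fst (𝕜 := ℝ) (p := z))
  have h2 : HasFDerivAt (fun z : ℝ × ℝ => z.1 ^ l * φ z.1) _ z :=
    HasDerivAt.comp_hasFDerivAt (h₂ := fun t => t ^ l * φ t) z
      ((hasDerivAt_pow l z.1).fun_mul hφ.hasDerivAt) (hasFDerivAt_fst (𝕜 := ℝ) (p := z))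
  have h3 : HasFDerivAt (fun z : ℝ × ℝ => β * z.1 ^ m) _ z :=
    HasDerivAt.comp_hasFDerivAt (h₂ := fun t => β * t ^ m) z ((hasDerivAt_pow m z.1).const_mul β) (hasFDerivAt_fst (𝕜 := ℝ) (p := z))
  refine ⟨_, h1.prodMk (h2.add (h3.mul hasFDerivAt_snd)), ?_⟩
  rw [det_eq]
  have : l + m - 1 = l - 1 + m := by omega
  simp [this, pow_add]
  ring

theorem hasFDerivAt_monomial (k j : ℕ) (z : ℝ × ℝ) :
    ∃ D : ℝ × ℝ →L[ℝ] ℝ, HasFDerivAt (fun z : ℝ × ℝ => z.1 ^ k * z.2 ^ j) D z ∧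
      D (1, 0) = k * z.1 ^ (k - 1) * z.2 ^ j ∧ D (0, 1) = j * z.1 ^ k * z.2 ^ (j - 1) := by
  have h1 : HasFDerivAt (fun z : ℝ × ℝ => z.1 ^ k) _ z :=
    HasDerivAt.comp_hasFDerivAt (h₂ := fun t => t ^ k) z (hasDerivAt_pow k z.1) (hasFDerivAt_fst (𝕜 := ℝ) (p := z))
  have h2 : HasFDerivAt (fun z : ℝ × ℝ => z.2 ^ j) _ z :=
    HasDerivAt.comp_hasFDerivAt (h₂ := fun t => t ^ j) z (hasDerivAt_pow j z.2) (hasFDerivAt_snd (𝕜 := ℝ) (p := z))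
  refine ⟨_, h1.mul h2, ?_, ?_⟩ <;> simp <;> ring

/-- The part of the second component that is a function of `s` has gradient parallel to that of `s ^
e` and drops out; only the Jacobian of the two monomials `s` and `u ^ n * v ^ p` remains. -/
theorem hasFDerivAt_crossForm {k j e n p : ℕ} {α β : ℝ} {φ : ℝ → ℝ} {z : ℝ × ℝ}
    (hk : 0 < k) (hj : 0 < j) (he : 0 < e) (hn : 0 < n) (hp : 0 < p)
    (hφ : DifferentiableAt ℝ φ (z.1 ^ k * z.2 ^ j)) :
    ∃ D : ℝ × ℝ →L[ℝ] ℝ × ℝ,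
      HasFDerivAt (fun z : ℝ × ℝ => (α * (z.1 ^ k * z.2 ^ j) ^ e,
        (z.1 ^ k * z.2 ^ j) ^ e * φ (z.1 ^ k * z.2 ^ j) + β * (z.1 ^ n * z.2 ^ p))) D z ∧
      D.det = α * β * e * ((k : ℝ) * p - j * n) *
        (z.1 ^ (k * e + n - 1) * z.2 ^ (j * e + p - 1)) := by
  obtain ⟨S, hS, hS1, hS2⟩ := hasFDerivAt_monomial k j z
  obtain ⟨T, hT, hT1, hT2⟩ := hasFDerivAt_monomial n p z
  have h1 : HasFDerivAt (fun z : ℝ × ℝ => α * (z.1 ^ k * z.2 ^ j) ^ e) _ z :=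
    HasDerivAt.comp_hasFDerivAt (h₂ := fun t => α * t ^ e) z
      ((hasDerivAt_pow e (z.1 ^ k * z.2 ^ j)).const_mul α) hS
  have h2 : HasFDerivAt (fun z : ℝ × ℝ => (z.1 ^ k * z.2 ^ j) ^ e * φ (z.1 ^ k * z.2 ^ j)) _ z :=
    HasDerivAt.comp_hasFDerivAt (h₂ := fun t => t ^ e * φ t) z
      ((hasDerivAt_pow e (z.1 ^ k * z.2 ^ j)).fun_mul hφ.hasDerivAt) hS
  refine ⟨_, h1.prodMk (h2.add (hT.const_mul β)), ?_⟩
  -- Writing all exponents as successors removes the truncated subtractions, so that `ring` can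
  -- compare the two sides.
  obtain ⟨k, rfl⟩ := Nat.exists_eq_succ_of_ne_zero hk.ne'
  obtain ⟨j, rfl⟩ := Nat.exists_eq_succ_of_ne_zero hj.ne'
  obtain ⟨e, rfl⟩ := Nat.exists_eq_succ_of_ne_zero he.ne'
  obtain ⟨n, rfl⟩ := Nat.exists_eq_succ_of_ne_zero hn.ne'
  obtain ⟨p, rfl⟩ := Nat.exists_eq_succ_of_ne_zero hp.ne'
  have e1 : (k + 1) * (e + 1) + (n + 1) - 1 = k + (k + 1) * e + (n + 1) :=
    Nat.sub_eq_of_eq_add (by ring)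
  have e2 : (j + 1) * (e + 1) + (p + 1) - 1 = j + (j + 1) * e + (p + 1) :=
    Nat.sub_eq_of_eq_add (by ring)
  rw [det_eq]
  simp only [Nat.succ_eq_add_one, Nat.add_sub_cancel] at hS1 hS2 hT1 hT2 ⊢
  rw [e1, e2]
  simp [hS1, hS2, hT1, hT2]
  ring

end Main

theorem lemma4p1 {M : Type u} [TopologicalSpace M] [ChartedSpace (ℝ × ℝ) M]
    [IsManifold 𝓘(ℝ, ℝ × ℝ) ω M] (π : M → ℝ × ℝ) (hπ : IsBlowupComposition π)
    (a : M) (ha : a ∈ exceptionalDivisor π) :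
    -- at a non-corner point of the exceptional divisor
    (¬ IsCornerPoint (exceptionalDivisor π) a →
      ∃ ψ : OpenPartialHomeomorph M (ℝ × ℝ), IsAnalyticCoord ψ a ∧
        GermEqAxis (exceptionalDivisor π) ψ a ∧
        ∃ l m l' : ℕ, 0 < l ∧ l ≤ m ∧
          pullbackIdeal π a = germIdeal a {fun q => (ψ q).1 ^ l} ∧
          jacobianIdeal π a = germIdeal a {fun q => (ψ q).1 ^ l'} ∧
          2 * l - 1 ≤ l' ∧ l' = l + m - 1 ∧
          ∃ (θ α β : ℝ) (φ : ℝ → ℝ), (α = 1 ∨ α = -1) ∧ (β = 1 ∨ β = -1) ∧ AnalyticAt ℝ φ 0 ∧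
            ∀ᶠ q in 𝓝 a, planeRotation θ (π q) =
              (α * (ψ q).1 ^ l, (ψ q).1 ^ l * φ (ψ q).1 + β * (ψ q).1 ^ m * (ψ q).2)) ∧
    -- at a corner point of the exceptional divisor
    (IsCornerPoint (exceptionalDivisor π) a →
      ∃ ψ : OpenPartialHomeomorph M (ℝ × ℝ), IsAnalyticCoord ψ a ∧
        GermEqCross (exceptionalDivisor π) ψ a ∧
        ∃ l m n p l' m' : ℕ, 0 < l ∧ 0 < m ∧ l ≤ n ∧ m ≤ p ∧
          (l : ℤ) * p - m * n ≠ 0 ∧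
          pullbackIdeal π a = germIdeal a {fun q => (ψ q).1 ^ l * (ψ q).2 ^ m} ∧
          jacobianIdeal π a = germIdeal a {fun q => (ψ q).1 ^ l' * (ψ q).2 ^ m'} ∧
          2 * l - 1 ≤ l' ∧ 2 * m - 1 ≤ m' ∧ l' = l + n - 1 ∧ m' = m + p - 1 ∧
          -- `φ(t) = t * h (t ^ (1 / e))`, where for `t = u ^ l * v ^ m` the `e`-th root of `t` is
          -- the monomial `u ^ (l / e) * v ^ (m / e)`
          ∃ (θ α β : ℝ) (h : ℝ → ℝ) (e : ℕ), (α = 1 ∨ α = -1) ∧ (β = 1 ∨ β = -1) ∧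
            AnalyticAt ℝ h 0 ∧ 0 < e ∧ e ∣ l ∧ e ∣ m ∧
            ∀ᶠ q in 𝓝 a, planeRotation θ (π q) =
              (α * ((ψ q).1 ^ l * (ψ q).2 ^ m),
                (ψ q).1 ^ l * (ψ q).2 ^ m * h ((ψ q).1 ^ (l / e) * (ψ q).2 ^ (m / e)) +
                  β * ((ψ q).1 ^ n * (ψ q).2 ^ p))) := by
  constructor
  · intro hc
    rcases hπ.hasForm a ha with h | h
    · obtain ⟨X, ⟨ψ, hψ, hX⟩, l, m, θ, α, β, φ, hl, hm, hα, hβ, hφ, ev⟩ := h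
      have ev : ∀ᶠ q in 𝓝 a, planeRotation θ (π q) =
          (α * (ψ q).1 ^ l, (ψ q).1 ^ l * φ (ψ q).1 + β * (ψ q).1 ^ m * (ψ q).2) := by
        filter_upwards [ev, hX] with q hq hq'
        rw [hq, hq']
      have hαβ : α * β * l ≠ 0 := by
        have : (l : ℝ) ≠ 0 := by positivity
        rcases hα with rfl | rfl <;> rcases hβ with rfl | rfl <;> simpa
      have hφ1 : AnalyticAt ℝ (fun z : ℝ × ℝ => φ z.1) 0 :=
        AnalyticAt.fun_comp (g := φ) hφ analyticAt_fst
      refine ⟨ψ, hψ, eventually_mem_exceptionalDivisor_axis hl hm hα ev, l, m, l + m - 1, hl, hm,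
        pullbackIdeal_eq_of_form hψ (w := fun z => z.1 ^ l)
          (B := fun z => φ z.1 + β * z.1 ^ (m - l) * z.2) (θ := θ) hα (analyticAt_fst.pow l)
          (by simp [hl.ne']) (hφ1.add ((analyticAt_const.mul (analyticAt_fst.pow _)).mul
            analyticAt_snd)) ?_,
        jacobianIdeal_eq_of_form hψ (θ := θ) (w := fun z => z.1 ^ (l + m - 1))
          (N := fun z => (α * z.1 ^ l, z.1 ^ l * φ z.1 + β * z.1 ^ m * z.2)) hαβ (analyticAt_fst.pow _)
          ?_ ev, by omega, rfl, θ, α, β, φ, hα, hβ, hφ, ev⟩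
      · filter_upwards [ev] with q hq
        rw [hq]
        have : (ψ q).1 ^ m = (ψ q).1 ^ l * (ψ q).1 ^ (m - l) := by
          rw [← pow_add]; congr 1; omega
        ext
        · rfl
        · simp only [this]; ring
      · have ht : Tendsto (fun z : ℝ × ℝ => z.1) (𝓝 0) (𝓝 0) := continuous_fst.tendsto 0
        filter_upwards [ht.eventually hφ.eventually_analyticAt] with z hz
        exact hasFDerivAt_axisForm hl hz.differentiableAt
    · obtain ⟨X, ⟨ψ, hψ, hX⟩, k, j, e, n, p, θ, α, β, φ, hk, hj, he, hn, hp, hd, hα, hβ, hφ, ev⟩ := h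
      have hn0 : 0 < n := (Nat.mul_pos hk he).trans_le hn
      have hp0 : 0 < p := (Nat.mul_pos hj he).trans_le hp
      -- The coordinates of a cross form themselves witness that `a` is a corner point.
      refine absurd ⟨ψ, hψ, ?_⟩ hc
      filter_upwards [eventually_mem_exceptionalDivisor_cross hk hj he hn0 hp0 hα ev, hX]
        with q hq hq'
      rw [hq, hq']
  · intro hc
    rcases hπ.hasForm a ha with h | h
    · obtain ⟨X, hX, l, m, θ, α, β, φ, hl, hm, hα, hβ, hφ, ev⟩ := h
      exact absurd hc (not_isCornerPoint_of_axis hX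
        (eventually_mem_exceptionalDivisor_axis hl hm hα ev))
    · obtain ⟨X, ⟨ψ, hψ, hX⟩, k, j, e, n, p, θ, α, β, φ, hk, hj, he, hn, hp, hd, hα, hβ, hφ, ev⟩ := h
      have hn0 : 0 < n := (Nat.mul_pos hk he).trans_le hn
      have hp0 : 0 < p := (Nat.mul_pos hj he).trans_le hp
      have hke := Nat.mul_pos hk he
      have hje := Nat.mul_pos hj he
      have ev : ∀ᶠ q in 𝓝 a, planeRotation θ (π q) = (α * ((ψ q).1 ^ k * (ψ q).2 ^ j) ^ e,
          ((ψ q).1 ^ k * (ψ q).2 ^ j) ^ e * φ ((ψ q).1 ^ k * (ψ q).2 ^ j) +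
            β * ((ψ q).1 ^ n * (ψ q).2 ^ p)) := by
        filter_upwards [ev, hX] with q hq hq'
        rw [hq, hq']
      have he0 : (e : ℝ) ≠ 0 := by positivity
      have hαβ : α * β * e * ((k : ℝ) * p - j * n) ≠ 0 := by
        refine mul_ne_zero (mul_ne_zero ?_ he0) hd
        rcases hα with rfl | rfl <;> rcases hβ with rfl | rfl <;> norm_num
      have hs : ∀ i i' : ℕ, AnalyticAt ℝ (fun z : ℝ × ℝ => z.1 ^ i * z.2 ^ i') 0 := fun i i' =>
        (analyticAt_fst.pow i).mul (analyticAt_snd.pow i')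
      have hs0 : ((0 : ℝ × ℝ).1 ^ k * (0 : ℝ × ℝ).2 ^ j : ℝ) = 0 := by simp [hk.ne']
      have hφ1 : AnalyticAt ℝ (fun z : ℝ × ℝ => φ (z.1 ^ k * z.2 ^ j)) 0 :=
        AnalyticAt.fun_comp (g := φ) (by rw [hs0]; exact hφ) (hs k j)
      refine ⟨ψ, hψ, eventually_mem_exceptionalDivisor_cross hk hj he hn0 hp0 hα ev,
        k * e, j * e, n, p, k * e + n - 1, j * e + p - 1, hke, hje, hn, hp, ?_,
        pullbackIdeal_eq_of_form hψ (w := fun z => z.1 ^ (k * e) * z.2 ^ (j * e))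
          (B := fun z => φ (z.1 ^ k * z.2 ^ j) + β * (z.1 ^ (n - k * e) * z.2 ^ (p - j * e)))
          (θ := θ) hα (hs _ _) (by simp [hk.ne', he.ne']) (hφ1.add (analyticAt_const.mul (hs _ _)))
          ?_,
        jacobianIdeal_eq_of_form hψ (θ := θ)
          (N := fun z => (α * (z.1 ^ k * z.2 ^ j) ^ e,
            (z.1 ^ k * z.2 ^ j) ^ e * φ (z.1 ^ k * z.2 ^ j) + β * (z.1 ^ n * z.2 ^ p)))
          (w := fun z => z.1 ^ (k * e + n - 1) * z.2 ^ (j * e + p - 1)) hαβ (hs _ _) ?_ ev,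
        by omega, by omega, rfl, rfl, θ, α, β, φ, e, hα, hβ, hφ, he, dvd_mul_left _ _,
        dvd_mul_left _ _, ?_⟩
      · intro h
        have h' : ((k * e : ℕ) : ℝ) * p - (j * e : ℕ) * n = 0 := by exact_mod_cast h
        push_cast at h'
        exact mul_ne_zero he0 hd (by linear_combination h')
      · filter_upwards [ev] with q hq
        rw [hq]
        have e1 : (ψ q).1 ^ n = (ψ q).1 ^ (k * e) * (ψ q).1 ^ (n - k * e) := by
          rw [← pow_add]; congr 1; omega
        have e2 : (ψ q).2 ^ p = (ψ q).2 ^ (j * e) * (ψ q).2 ^ (p - j * e) := by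
          rw [← pow_add]; congr 1; omega
        ext
        · simp only; ring
        · simp only [e1, e2]; ring
      · have ht : Tendsto (fun z : ℝ × ℝ => z.1 ^ k * z.2 ^ j) (𝓝 0) (𝓝 0) := by
          have := (hs k j).continuousAt.tendsto
          rwa [hs0] at this
        filter_upwards [ht.eventually hφ.eventually_analyticAt] with z hz
        exact hasFDerivAt_crossForm hk hj he hn0 hp0 hz.differentiableAt
      · filter_upwards [ev] with q hq
        rw [hq, Nat.mul_div_cancel _ he, Nat.mul_div_cancel _ he]
        have e1 : ((ψ q).1 ^ k * (ψ q).2 ^ j) ^ e = (ψ q).1 ^ (k * e) * (ψ q).2 ^ (j * e) := by ring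
        rw [e1]
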